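/- Let $\Delta_1=[\alpha_1,\beta_1]$, $\Delta_2=[\alpha_2,\beta_2]$ with $\alpha_1<\beta_1<\alpha_2<\beta_2$. Let $\mu_1,\mu_2$ be finite positive Borel measures on $\Delta_1,\Delta_2$ such that * $\mu_1$ is absolutely continuous on $\Delta_1$ and its density extends to a holomorphic non-vanishing function in a neighbourhood of $\Delta_1$; * $\mu_2$ is an absolutely continuous Szegő measure on $\Delta_2$: $\int_{\Delta_2}\log\mu_2'(x)\,dx>-\infty$. For $\vec n=(n_1,n_2)\in\mathbb Z_{\ge 0}^2$, $|\vec n|=n_1+n_2$, let $P_{\vec n}$ be the monic polynomial of degree $|\vec n|$ with $\int P_{\vec n}(x)x^l\,d\mu_i(x)=0$ for $0\le l<n_i$, $i=1,2$. Let $x_{\vec n,1}<\dots<x_{\vec n,n_1}$ be the zeros of $P_{\vec n}$ on $\Delta_1$ and write $P_{\vec n}=P_{\vec n,1}P_{\vec n,2}$ with $P_{\vec n,1}(z)=\prod_i(z-x_{\vec n,i})$. Put $\vec e_1=(1,0)$, $\vec e_2=(0,1)$. Let $w_2(z)=\sqrt{(z-\alpha_2)(z-\beta_2)}$ be the branch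 holomorphic off $\Delta_2$ with $w_2(z)/z\to1$ as $z\to\infty$, let $w_{2+}$ be its trace on $\Delta_2$ from the upper half-plane, and set $$\varphi_2(z)=\tfrac12\Big(z-\tfrac{\alpha_2+\beta_2}2+w_2(z)\Big),\quad A_{0,2}=\Big(\tfrac{\beta_2-\alpha_2}4\Big)^2,\quad B_{0,2}=\tfrac{\alpha_2+\beta_2}2,\quad B_{0,1}=B_{0,2}+\varphi_2(\alpha_1),$$ $$\rho_2(x)=-2\pi i\,\mu_2'(x),\qquad S_{\rho_2}(z)=\exp\Big\{\frac{w_2(z)}{2\pi i}\int_{\Delta_2}\frac{\log(\rho_2w_{2+})(x)}{z-x}\frac{dx}{w_{2+}(x)}\Big\},$$ $$S(z;x_0)=\Big(\frac{\varphi_2(z)-\varphi_2(x_0)}{\varphi_2(x_0)\varphi_2(z)-A_{0,2}}\,\frac{\varphi_2(x_0)\varphi_2(z)}{z-x_0}\Big)^{1/2},\qquad S(\infty;x_0)=1,$$ the last being the branch holomorphic in $\overline{\mathbb C}\setminus\Delta_2$. For a set $\mathcal N$ of multi-indices consider the asymptotic formula $$(\ast)\qquad P_{\vec n,2}(z)=(1+o(1))\,\frac{S_{\rho_2}(z)}{S_{\rho_2}(\infty)}\Big(\prod_{i=1}^{n_1}S(z;x_{\vec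 n,i})\Big)\varphi_2(z)^{n_2}\qquad(|\vec n|\to\infty,\ \vec n\in\mathcal N),$$ uniformly on compact subsets of $\overline{\mathbb C}\setminus\Delta_2$ (validity of $(\ast)$ includes convergence of the integral that defines $S_{\rho_2}$). Let $\mathcal N_0$ be a marginal sequence of multi-indices, that is, $n_1/n_2\to0$ as $|\vec n|\to\infty$, $\vec n\in\mathcal N_0$, and assume that $(\ast)$ holds along $\mathcal N_0$. Then all zeros of $P_{\vec n}$ on $\Delta_1$ tend to $\alpha_1$: $\max_i|x_{\vec n,i}-\alpha_1|\to0$ as $|\vec n|\to\infty$, $\vec n\in\mathcal N_0$. Moreover, for each $i\in\{1,2\}$ such that $(\ast)$ also holds along the (again marginal) sequence $\{\vec n+\vec e_i:\vec n\in\mathcal N_0\}$, $$\lim_{|\vec n|\to\infty,\ \vec n\in\mathcal N_0}\ \lim_{z\to\infty}\Big(\frac{P_{\vec n+\vec e_i}(z)}{P_{\vec n}(z)}-z\Big)=-B_{0,i},$$ where the inner limit exists for every $\vec n\in\mathcal N_0$. Consequently $b_{\vec n,i}\to B_{0,i}$ along $\mathcal N_0$, where $a_{\vec n,j},b_{\vec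 n,j}$ are real coefficients of the nearest-neighbour recurrence relations $zP_{\vec n}(z)=P_{\vec n+\vec e_j}(z)+b_{\vec n,j}P_{\vec n}(z)+a_{\vec n,1}P_{\vec n-\vec e_1}(z)+a_{\vec n,2}P_{\vec n-\vec e_2}(z)$, $j=1,2$ (terms with $n_k=0$, i.e. $P_{\vec n-\vec e_k}$ undefined, are absent). -/

import Mathlib

open MeasureTheory Filter Topology Set

noncomputable section

namespace Angelesco

/-- `|n| → ∞` along the set of multi-indices `N`. -/
def along (N : Set (ℕ × ℕ)) : Filter (ℕ × ℕ) :=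
  comap (fun n : ℕ × ℕ => n.1 + n.2) atTop ⊓ 𝓟 N

/-- `N` is a marginal sequence of multi-indices: `n₁ / n₂ → 0` as `|n| → ∞`, `n ∈ N`
(in particular `n₂` is eventually positive). -/
def IsMarginal (N : Set (ℕ × ℕ)) : Prop :=
  (∀ᶠ n in along N, 0 < n.2) ∧ Tendsto (fun n : ℕ × ℕ => (n.1 : ℝ) / (n.2 : ℝ)) (along N) (𝓝 0)

/-- The standard unit multi-indices `e₁ = (1, 0)`, `e₂ = (0, 1)`. -/
def e : Fin 2 → ℕ × ℕ := ![(1, 0), (0, 1)]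

/-- `p` is the monic type II multiple orthogonal polynomial of multi-index `n`. -/
def IsTypeII (μ₁ μ₂ : Measure ℝ) (n : ℕ × ℕ) (p : Polynomial ℝ) : Prop :=
  p.Monic ∧ p.natDegree = n.1 + n.2 ∧
    (∀ l < n.1, ∫ x, p.eval x * x ^ l ∂μ₁ = 0) ∧
    (∀ l < n.2, ∫ x, p.eval x * x ^ l ∂μ₂ = 0)

/-- `μ` is absolutely continuous on `[a, b]`, and its density extends to a holomorphic
non-vanishing function in a neighbourhood of `[a, b]`. -/
def HasAnalyticDensity (μ : Measure ℝ) (a b : ℝ) : Prop :=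
  ∃ (U : Set ℂ) (f : ℂ → ℂ), IsOpen U ∧ (∀ x ∈ Icc a b, (x : ℂ) ∈ U) ∧
    DifferentiableOn ℂ f U ∧ (∀ z ∈ U, f z ≠ 0) ∧
    (∀ x ∈ Icc a b, (f x).im = 0 ∧ 0 < (f x).re) ∧
    μ = (volume.restrict (Icc a b)).withDensity (fun x : ℝ => ENNReal.ofReal (f x).re)

/-- The density `μ'` of `μ` with respect to Lebesgue measure. -/
def density (μ : Measure ℝ) (x : ℝ) : ℝ := (μ.rnDeriv volume x).toReal

/-- `μ` is an absolutely continuous measure on `[a, b]` with `∫ log μ'(x) dx > -∞`.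
(As `log` of a finite measure's density is bounded above by an integrable function, this
says that `μ' > 0` almost everywhere and that `log μ'` is integrable.) -/
def IsSzegoMeasure (μ : Measure ℝ) (a b : ℝ) : Prop :=
  μ ≪ volume ∧ μ (Icc a b)ᶜ = 0 ∧ (∀ᵐ x ∂volume.restrict (Icc a b), 0 < density μ x) ∧
    IntegrableOn (fun x => Real.log (density μ x)) (Icc a b)

/-- The branch of `√((z - a)(z - b))` that is holomorphic outside of `[a, b]` and
behaves like `z` at infinity; see `w_sq`, `differentiableAt_w`, `tendsto_w_div`. -/
def w (a b : ℝ) (z : ℂ) : ℂ :=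
  (z - ((a + b) / 2 : ℝ)) *
    (1 - (((b - a) / 2 : ℝ) / (z - ((a + b) / 2 : ℝ))) ^ 2) ^ (1 / 2 : ℂ)

theorem arg_mem_slitPlane {a b : ℝ} {z : ℂ} (hz : ∀ x ∈ Icc a b, (x : ℂ) ≠ z) (hab : a < b) :
    1 - ((((b - a) / 2 : ℝ) : ℂ) / (z - ((a + b) / 2 : ℝ))) ^ 2 ∈ Complex.slitPlane := by
  have hm : z - ((a + b) / 2 : ℝ) ≠ 0 := by
    intro h
    exact hz ((a + b) / 2) ⟨by linarith, by linarith⟩ (sub_eq_zero.mp h).symm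
  set r : ℝ := (b - a) / 2 with hr
  set u : ℂ := (r : ℂ) / (z - ((a + b) / 2 : ℝ)) with hu
  by_contra hn
  rw [Complex.mem_slitPlane_iff, not_or, not_lt, not_not] at hn
  obtain ⟨h1, h2⟩ := hn
  simp only [pow_two, Complex.sub_re, Complex.sub_im, Complex.mul_re, Complex.mul_im,
    Complex.one_re, Complex.one_im] at h1 h2
  have hr0 : 0 < r := by rw [hr]; linarith
  have him : u.im = 0 := by
    by_contra h
    have : u.re = 0 := by
      have : u.re * u.im = 0 := by linarith
      exact (mul_eq_zero.mp this).resolve_right h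
    rw [this] at h1
    nlinarith [mul_self_nonneg u.im]
  rw [him] at h1
  have hure : u = (u.re : ℂ) := Complex.ext rfl (by simpa using him)
  have hu0 : u.re ≠ 0 := by
    intro h; rw [h] at h1; norm_num at h1
  have hzz : z = ((((a + b) / 2) + r / u.re : ℝ) : ℂ) := by
    have h3 : u * (z - ((a + b) / 2 : ℝ)) = r := by
      rw [hu]; field_simp
    rw [hure] at h3
    have h4 : (u.re : ℂ) ≠ 0 := by exact_mod_cast hu0
    push_cast at h3 ⊢
    field_simp
    linear_combination 2 * h3
  have hle : |r / u.re| ≤ r := by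
    rw [abs_div, abs_of_pos hr0, div_le_iff₀ (abs_pos.mpr hu0)]
    have : 1 ≤ |u.re| := by
      rw [← sq_le_sq₀ zero_le_one (abs_nonneg _), sq_abs]; nlinarith
    nlinarith
  obtain ⟨h5, h6⟩ := abs_le.mp hle
  exact hz _ ⟨by rw [hr] at h5; linarith, by rw [hr] at h6; linarith⟩ hzz.symm

theorem w_sq {a b : ℝ} {z : ℂ} (hm : z ≠ ((a + b) / 2 : ℝ)) :
    w a b z ^ 2 = (z - a) * (z - b) := by
  have hm' : z - ((a + b) / 2 : ℝ) ≠ 0 := sub_ne_zero.mpr hm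
  rw [w, mul_pow, one_div, show (2 : ℂ)⁻¹ = ((2 : ℕ) : ℂ)⁻¹ by norm_num,
    Complex.cpow_nat_inv_pow _ two_ne_zero]
  field_simp
  push_cast
  ring

theorem differentiableAt_w {a b : ℝ} {z : ℂ} (hab : a < b) (hz : ∀ x ∈ Icc a b, (x : ℂ) ≠ z) :
    DifferentiableAt ℂ (w a b) z := by
  have hm : z - ((a + b) / 2 : ℝ) ≠ 0 := by
    intro h
    exact hz ((a + b) / 2) ⟨by linarith, by linarith⟩ (sub_eq_zero.mp h).symm
  unfold w
  have h1 : DifferentiableAt ℂ (fun z : ℂ => z - ((a + b) / 2 : ℝ)) z :=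
    differentiableAt_id.sub_const _
  have h2 : DifferentiableAt ℂ
      (fun z : ℂ => 1 - ((((b - a) / 2 : ℝ) : ℂ) / (z - ((a + b) / 2 : ℝ))) ^ 2) z :=
    (((differentiableAt_const _).div h1 hm).pow 2).const_sub 1
  exact h1.mul (h2.cpow_const (arg_mem_slitPlane hz hab))

theorem tendsto_w_div (a b : ℝ) :
    Tendsto (fun z => w a b z / z) (Bornology.cobounded ℂ) (𝓝 1) := by
  have h0 : Tendsto (fun z : ℂ => z⁻¹) (Bornology.cobounded ℂ) (𝓝 0) :=
    tendsto_inv₀_cobounded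
  have h1 : Tendsto (fun z : ℂ => (z - ((a + b) / 2 : ℝ))⁻¹) (Bornology.cobounded ℂ) (𝓝 0) :=
    tendsto_inv₀_cobounded.comp (tendsto_sub_const_cobounded _)
  have h2 : Tendsto (fun z : ℂ => (1 - ((((b - a) / 2 : ℝ) : ℂ) *
      (z - ((a + b) / 2 : ℝ))⁻¹) ^ 2) ^ (1 / 2 : ℂ)) (Bornology.cobounded ℂ) (𝓝 1) := by
    have h3 : Tendsto (fun z : ℂ => 1 - ((((b - a) / 2 : ℝ) : ℂ) *
        (z - ((a + b) / 2 : ℝ))⁻¹) ^ 2) (Bornology.cobounded ℂ) (𝓝 1) := by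
      simpa using tendsto_const_nhds.sub ((h1.const_mul (((b - a) / 2 : ℝ) : ℂ)).pow 2)
    simpa using h3.cpow (tendsto_const_nhds (x := (1 / 2 : ℂ))) (by simp)
  have h4 : Tendsto (fun z : ℂ => 1 - (((a + b) / 2 : ℝ) : ℂ) * z⁻¹)
      (Bornology.cobounded ℂ) (𝓝 1) := by
    simpa using tendsto_const_nhds.sub (h0.const_mul (((a + b) / 2 : ℝ) : ℂ))
  have h5 := h4.mul h2
  rw [one_mul] at h5
  refine h5.congr' ?_
  filter_upwards [Bornology.eventually_ne_cobounded (0 : ℂ)] with z hz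
  simp only [w]
  rw [← div_eq_mul_inv (((b - a) / 2 : ℝ) : ℂ), show (1 - (((a + b) / 2 : ℝ) : ℂ) * z⁻¹) = (z - ((a + b) / 2 : ℝ)) * z⁻¹ by
    rw [sub_mul, mul_inv_cancel₀ hz]]
  ring

/-- The trace of `w a b` on `[a, b]` from the upper half-plane. -/
def wPlus (a b x : ℝ) : ℂ := Complex.I * (Real.sqrt ((x - a) * (b - x)) : ℝ)

/-- The conformal map `φ` of the complement of `[a, b]` onto the complement of the disk of
radius `(b - a) / 4` with `φ(z) = z + O(1)`. -/
def phi (a b : ℝ) (z : ℂ) : ℂ := (z - ((a + b) / 2 : ℝ) + w a b z) / 2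

/-- `ρ(x) = -2πi μ'(x)`. -/
def rho (μ : Measure ℝ) (x : ℝ) : ℂ := -2 * Real.pi * Complex.I * (density μ x : ℂ)

/-- The Szegő function `S_ρ` of `μ` outside of `[a, b]`. On `(a, b)` the quantity `ρ w₊` is
non-negative. -/
def szego (μ : Measure ℝ) (a b : ℝ) (z : ℂ) : ℂ :=
  Complex.exp (w a b z / (2 * Real.pi * Complex.I) *
    ∫ x in Icc a b, Complex.log (rho μ x * wPlus a b x) / (z - x) / wPlus a b x)

/-- The value `S_ρ(∞)`, since `w(z) / (z - x) → 1` as `z → ∞`. -/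
def szegoInf (μ : Measure ℝ) (a b : ℝ) : ℂ :=
  Complex.exp (1 / (2 * Real.pi * Complex.I) *
    ∫ x in Icc a b, Complex.log (rho μ x * wPlus a b x) / wPlus a b x)

/-- The integral defining the Szegő function converges. -/
def SzegoDefined (μ : Measure ℝ) (a b : ℝ) : Prop :=
  IntegrableOn (fun x => Complex.log (rho μ x * wPlus a b x) / wPlus a b x) (Icc a b)

/-- `A = ((b - a) / 4)²`. -/
def constA (a b : ℝ) : ℝ := ((b - a) / 4) ^ 2

/-- The function
`S(z; x₀) = ( (φ(z) - φ(x₀)) / (φ(x₀) φ(z) - A) · φ(x₀) φ(z) / (z - x₀) ) ^ (1/2)`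
with `S(∞; x₀) = 1`. The quotient `(φ(z) - φ(x₀)) / (z - x₀)` is written as `dslope φ x₀ z`,
so that it is `φ'(x₀)` at the removable singularity `z = x₀`. The principal root is the
holomorphic branch with value `1` at infinity; see `S_eq`. -/
def S (a b : ℝ) (z : ℂ) (x₀ : ℝ) : ℂ :=
  (dslope (phi a b) (x₀ : ℂ) z * (phi a b x₀ * phi a b z) /
    (phi a b x₀ * phi a b z - constA a b)) ^ (1 / 2 : ℂ)

theorem phi_quadratic {a b : ℝ} {z : ℂ} (hm : z ≠ ((a + b) / 2 : ℝ)) :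
    phi a b z ^ 2 - (z - ((a + b) / 2 : ℝ)) * phi a b z + constA a b = 0 := by
  have h := w_sq hm
  simp only [phi, constA]
  push_cast at h ⊢
  linear_combination (1 / 4) * h

theorem norm_phi_gt {a b : ℝ} {z : ℂ} (hab : a < b) (hz : ∀ x ∈ Icc a b, (x : ℂ) ≠ z) :
    (b - a) / 4 < ‖phi a b z‖ := by
  have hm : z ≠ ((a + b) / 2 : ℝ) := fun h =>
    hz ((a + b) / 2) ⟨by linarith, by linarith⟩ h.symm
  have hm' : z - ((a + b) / 2 : ℝ) ≠ 0 := sub_ne_zero.mpr hm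
  set s : ℂ := (1 - ((((b - a) / 2 : ℝ) : ℂ) / (z - ((a + b) / 2 : ℝ))) ^ 2) ^ (1 / 2 : ℂ) with hs
  have hre : 0 < s.re := by
    have harg := arg_mem_slitPlane hz hab
    have hne := Complex.slitPlane_ne_zero harg
    have hpi := (Complex.mem_slitPlane_iff_arg.mp harg).1
    rw [hs, Complex.cpow_def_of_ne_zero hne, Complex.exp_re]
    refine mul_pos (Real.exp_pos _) (Real.cos_pos_of_mem_Ioo ?_)
    have h1 := Complex.neg_pi_lt_arg
      (1 - ((((b - a) / 2 : ℝ) : ℂ) / (z - ((a + b) / 2 : ℝ))) ^ 2)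
    have h2 := lt_of_le_of_ne (Complex.arg_le_pi _) hpi
    have h3 : (Complex.log (1 - ((((b - a) / 2 : ℝ) : ℂ) / (z - ((a + b) / 2 : ℝ))) ^ 2) *
        (1 / 2 : ℂ)).im =
        Complex.arg (1 - ((((b - a) / 2 : ℝ) : ℂ) / (z - ((a + b) / 2 : ℝ))) ^ 2) / 2 := by
      rw [show (1 / 2 : ℂ) = ((1 / 2 : ℝ) : ℂ) by push_cast; rfl, Complex.im_mul_ofReal,
        Complex.log_im]
      ring
    rw [h3]
    constructor <;> linarith
  have hw : w a b z = (z - ((a + b) / 2 : ℝ)) * s := rfl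
  have hphi : phi a b z = (z - ((a + b) / 2 : ℝ)) * (1 + s) / 2 := by
    rw [phi, hw]; ring
  have hprod : phi a b z * ((z - ((a + b) / 2 : ℝ)) * (1 - s) / 2) = constA a b := by
    have h := phi_quadratic hm
    rw [hphi] at h ⊢
    linear_combination -h
  have hlt : ‖1 - s‖ < ‖1 + s‖ := by
    rw [← sq_lt_sq₀ (norm_nonneg _) (norm_nonneg _), ← Complex.normSq_eq_norm_sq,
      ← Complex.normSq_eq_norm_sq, Complex.normSq_apply, Complex.normSq_apply]
    simp only [Complex.sub_re, Complex.add_re, Complex.one_re, Complex.sub_im, Complex.add_im,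
      Complex.one_im]
    nlinarith
  have hlt2 : ‖(z - ((a + b) / 2 : ℝ)) * (1 - s) / 2‖ < ‖phi a b z‖ := by
    rw [hphi, norm_div, norm_div, norm_mul, norm_mul]
    have := norm_pos_iff.mpr hm'
    have h2 : (0 : ℝ) < ‖(2 : ℂ)‖ := by simp
    gcongr
  have hn := congrArg norm hprod
  rw [norm_mul, Complex.norm_real, constA, Real.norm_of_nonneg (by positivity)] at hn
  have hpos : 0 < ‖phi a b z‖ := (norm_nonneg _).trans_lt hlt2
  by_contra hcon
  rw [not_lt] at hcon
  nlinarith [mul_lt_mul_of_pos_left hlt2 hpos]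

theorem hasDerivAt_phi {a b : ℝ} {z : ℂ} (hab : a < b) (hz : ∀ x ∈ Icc a b, (x : ℂ) ≠ z) :
    HasDerivAt (phi a b) (phi a b z / w a b z) z := by
  have hm : z ≠ ((a + b) / 2 : ℝ) := fun h =>
    hz ((a + b) / 2) ⟨by linarith, by linarith⟩ h.symm
  have hsq := w_sq hm
  have hw0 : w a b z ≠ 0 := by
    intro h
    rw [h, zero_pow two_ne_zero] at hsq
    rcases mul_eq_zero.mp hsq.symm with h | h
    · exact hz a ⟨le_rfl, hab.le⟩ (sub_eq_zero.mp h).symm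
    · exact hz b ⟨hab.le, le_rfl⟩ (sub_eq_zero.mp h).symm
  have hd := (differentiableAt_w hab hz).hasDerivAt
  have h1 := hd.pow 2
  have h2 : HasDerivAt (fun y : ℂ => (y - a) * (y - b)) ((z - b) + (z - a)) z := by
    refine (((hasDerivAt_id z).sub_const (a : ℂ)).mul
      ((hasDerivAt_id z).sub_const (b : ℂ))).congr_deriv ?_
    simp
  have h3 : (fun y : ℂ => (y - a) * (y - b)) =ᶠ[𝓝 z] (w a b ^ 2) := by
    filter_upwards [isOpen_ne.mem_nhds hm] with y hy
    exact (w_sq hy).symm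
  have h4 := h1.unique (h2.congr_of_eventuallyEq h3.symm)
  have hd' : deriv (w a b) z = (z - ((a + b) / 2 : ℝ)) / w a b z := by
    rw [eq_div_iff hw0]
    push_cast at h4 ⊢
    linear_combination (1 / 2) * h4
  have h5 := (((hasDerivAt_id z).sub_const (((a + b) / 2 : ℝ) : ℂ)).add hd).div_const 2
  refine h5.congr_deriv ?_
  rw [hd', phi]
  field_simp
  ring

/-- Outside of `[a, b]` the function `S` is `φ(x₀) φ(z) / (φ(x₀) φ(z) - A)`; in particular the
principal root in its definition is the holomorphic branch with value `1` at infinity. -/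
theorem S_eq {a b x₀ : ℝ} {z : ℂ} (hab : a < b) (hz : ∀ x ∈ Icc a b, (x : ℂ) ≠ z)
    (hx₀ : x₀ ∉ Icc a b) :
    S a b z x₀ = phi a b x₀ * phi a b z / (phi a b x₀ * phi a b z - constA a b) := by
  have hx : ∀ x ∈ Icc a b, (x : ℂ) ≠ x₀ := by
    intro x hx h
    exact hx₀ (Complex.ofReal_injective h ▸ hx)
  have hm : z ≠ ((a + b) / 2 : ℝ) := fun h =>
    hz ((a + b) / 2) ⟨by linarith, by linarith⟩ h.symm
  have hmx : (x₀ : ℂ) ≠ ((a + b) / 2 : ℝ) := fun h =>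
    hx ((a + b) / 2) ⟨by linarith, by linarith⟩ h.symm
  have n1 := norm_phi_gt hab hz
  have n2 := norm_phi_gt hab hx
  have q1 := phi_quadratic hm
  have q2 := phi_quadratic hmx
  have d := (hasDerivAt_phi hab hx).deriv
  have wx : w a b x₀ = 2 * phi a b x₀ - (x₀ - ((a + b) / 2 : ℝ)) := by rw [phi]; ring
  have hr : 0 < (b - a) / 4 := by linarith
  have hp0 : phi a b z ≠ 0 := norm_pos_iff.mp (hr.trans n1)
  have hpx0 : phi a b x₀ ≠ 0 := norm_pos_iff.mp (hr.trans n2)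
  have hA : ‖(constA a b : ℂ)‖ < ‖phi a b x₀ * phi a b z‖ := by
    rw [Complex.norm_real, constA, Real.norm_of_nonneg (by positivity), norm_mul]
    nlinarith
  have hden : phi a b x₀ * phi a b z - constA a b ≠ 0 := by
    intro h
    rw [sub_eq_zero.mp h] at hA
    exact lt_irrefl _ hA
  unfold S
  set p := phi a b z
  set p₀ := phi a b x₀
  set A : ℂ := (constA a b : ℂ)
  have hrad : dslope (phi a b) (x₀ : ℂ) z * (p₀ * p) / (p₀ * p - A) =
      (p₀ * p / (p₀ * p - A)) ^ 2 := by
    have hslope : dslope (phi a b) (x₀ : ℂ) z = p₀ * p / (p₀ * p - A) := by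
      by_cases hzx : z = x₀
      · subst hzx
        rw [dslope_same, d]
        have hw : p₀ * w a b x₀ = p₀ * p₀ - A := by
          rw [wx]; linear_combination q2
        have hpp : p = p₀ := rfl
        rw [hpp] at hden ⊢
        rw [← hw] at hden ⊢
        have hw0 : w a b x₀ ≠ 0 := right_ne_zero_of_mul hden
        field_simp
      · rw [dslope_of_ne _ hzx, slope_def_field, div_eq_div_iff (sub_ne_zero.mpr hzx) hden]
        linear_combination p₀ * q1 - p * q2
    rw [hslope]; ring
  rw [hrad, one_div, show (2 : ℂ)⁻¹ = ((2 : ℕ) : ℂ)⁻¹ by norm_num]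
  have hre : 0 < (p₀ * p / (p₀ * p - A)).re := by
    rw [Complex.div_re]
    have hn := Complex.normSq_pos.mpr hden
    rw [← add_div]
    refine div_pos ?_ hn
    have key : (p₀ * p).re * (p₀ * p - A).re + (p₀ * p).im * (p₀ * p - A).im =
        ‖p₀ * p‖ ^ 2 - constA a b * (p₀ * p).re := by
      rw [← Complex.normSq_eq_norm_sq, Complex.normSq_apply]
      simp only [A, Complex.sub_re, Complex.sub_im, Complex.ofReal_re, Complex.ofReal_im]
      ring
    rw [key]
    have hA0 : 0 ≤ constA a b := by unfold constA; positivity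
    rw [Complex.norm_real, Real.norm_of_nonneg hA0] at hA
    nlinarith [Complex.re_le_norm (p₀ * p), mul_le_mul_of_nonneg_left
      (Complex.re_le_norm (p₀ * p)) hA0]
  refine Complex.pow_cpow_nat_inv two_ne_zero ?_ ?_ <;>
  · have := Complex.abs_arg_lt_pi_div_two_iff.mpr (Or.inl hre)
    rw [abs_lt] at this
    push_cast
    linarith

/-- The zeros of `p` on `[a, b]`, with multiplicity. -/
def zerosOn (p : Polynomial ℝ) (a b : ℝ) : Multiset ℝ := by
  classical exact p.roots.filter (fun x => x ∈ Icc a b)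

/-- The monic polynomial `p₁` whose zeros are the zeros of `p` on `[a, b]`. -/
def factorOn (p : Polynomial ℝ) (a b : ℝ) : Polynomial ℝ :=
  ((zerosOn p a b).map (fun x => Polynomial.X - Polynomial.C x)).prod

/-- The complementary factor `p₂ = p / p₁`. -/
def cofactorOn (p : Polynomial ℝ) (a b : ℝ) : Polynomial ℝ := p /ₘ factorOn p a b

/-- The asymptotic formula
`P_{n,2}(z) = (1 + o(1)) (S_ρ₂(z) / S_ρ₂(∞)) (∏ᵢ S(z; x_{n,i})) φ₂(z)^n₂`
as `|n| → ∞`, `n ∈ N`, uniformly on compact subsets of the Riemann sphere minus `[α₂, β₂]`,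
where `x_{n,i}` are the zeros of `P_n` on `[α₁, β₁]` and `P_{n,2}(z) = P_n(z) / ∏ᵢ (z - x_{n,i})`. -/
def VaryingAsymptotics (α₁ β₁ α₂ β₂ : ℝ) (μ₂ : Measure ℝ) (P : ℕ × ℕ → Polynomial ℝ)
    (N : Set (ℕ × ℕ)) : Prop :=
  SzegoDefined μ₂ α₂ β₂ ∧
  ∀ K : Set (OnePoint ℂ), IsCompact K → (∀ x ∈ Icc α₂ β₂, ((x : ℂ) : OnePoint ℂ) ∉ K) →
    ∀ ε > 0, ∀ᶠ n in along N, ∀ z : ℂ, (z : OnePoint ℂ) ∈ K →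
      ∃ o : ℂ, ‖o‖ ≤ ε ∧
        Polynomial.aeval z (cofactorOn (P n) α₁ β₁) =
          (1 + o) * (szego μ₂ α₂ β₂ z / szegoInf μ₂ α₂ β₂) *
            ((zerosOn (P n) α₁ β₁).map (fun x => S α₂ β₂ z x)).prod * phi α₂ β₂ z ^ n.2

/-- The limiting constants `B_{0,1} = B_{0,2} + φ₂(α₁)` and `B_{0,2} = (α₂ + β₂) / 2`. -/
def B₀ (α₁ α₂ β₂ : ℝ) : Fin 2 → ℂ :=
  ![((α₂ + β₂) / 2 : ℝ) + phi α₂ β₂ α₁, ((α₂ + β₂) / 2 : ℝ)]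

/-- `a i n`, `b i n` are the coefficients of the nearest-neighbour recurrence relations
`z P_n = P_{n+e_j} + b_{n,j} P_n + a_{n,1} P_{n-e₁} + a_{n,2} P_{n-e₂}`, where a term
`a_{n,i} P_{n-e_i}` with `n_i = 0` is absent. -/
def IsRecurrence (P : ℕ × ℕ → Polynomial ℝ) (a b : Fin 2 → ℕ × ℕ → ℝ) : Prop :=
  ∀ (n : ℕ × ℕ) (j : Fin 2),
    Polynomial.X * P n = P (n + e j) + Polynomial.C (b j n) * P n
      + (if n.1 = 0 then 0 else Polynomial.C (a 0 n) * P (n.1 - 1, n.2))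
      + (if n.2 = 0 then 0 else Polynomial.C (a 1 n) * P (n.1, n.2 - 1))

end Angelesco

end

/-!
The zeros of `P_n` are simple, `n₁` of them on `[α₁, β₁]` and `n₂` on `[α₂, β₂]`, and `P_n` is
orthogonal on `[α₁, β₁]` with respect to the varying weight `|P_{n,2}| dμ₁`. This weight decreases
by a factor exponentially small in `n₂` between `α₁` and `α₁ + ε`. A zero `y ≥ α₁ + ε` would be
the centre of mass of the measure `∏_{x ≠ y} (t - x)² |P_{n,2}(t)| dμ₁(t)`; near `α₁` the product of
squares can only be exponentially small in `n₁ = o(n₂)` on a set of positive measure where `μ₁'`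
is bounded below, so most of the mass would lie left of `y`, a contradiction.

For the ratio, compare the coefficients of `1 / z` at infinity. Since `φ₂ + A₀₂ / φ₂ = z - B₀₂`, the
quotient of `P_{n,2}(z)` by `∏ S(z; x) φ₂(z) ^ n₂` is `1 + c_n / z + o(1 / z)`, where, up to
`n₁ B₀₁ + n₂ B₀₂` and the sum of `φ₂(x) - φ₂(α₁)` over the zeros `x` on `[α₁, β₁]`, `c_n` is the
subleading coefficient of `P_n`. The Szegő functions cancel in the ratio of two consecutive
quotients, which therefore tends to `1` uniformly near infinity, and the Schwarz lemma at infinity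
yields `c_{n + e_i} - c_n → 0`. The sums over the zeros differ by `o(1)` as well: the zeros of
`P_n` and `P_{n + e_i}` on `[α₁, β₁]` interlace and tend to `α₁`, and `φ₂` is monotone there.
-/

noncomputable section

namespace Angelesco

section Orthogonality

open Polynomial

variable {μ : Measure ℝ} {a b : ℝ} {m n : ℕ} {p q Q : ℝ[X]}

theorem integrable_of_continuous [IsFiniteMeasure μ] (hμ : μ (Icc a b)ᶜ = 0) {f : ℝ → ℝ}
    (hf : Continuous f) : Integrable f μ := by
  rw [← Measure.restrict_eq_self_of_ae_mem (mem_ae_iff.mpr hμ)]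
  exact hf.continuousOn.integrableOn_Icc

/-- `Q` is orthogonal to the polynomials of degree less than `n` with respect to `μ`, tested on
monomials as in `IsTypeII`. -/
def IsOrthogonal (μ : Measure ℝ) (n : ℕ) (Q : ℝ[X]) : Prop :=
  ∀ l < n, ∫ x, Q.eval x * x ^ l ∂μ = 0

theorem IsOrthogonal.mono (h : IsOrthogonal μ n Q) (hmn : m ≤ n) : IsOrthogonal μ m Q :=
  fun l hl => h l (hl.trans_le hmn)

theorem IsOrthogonal.C_mul_add_C_mul [IsFiniteMeasure μ] (hμ : μ (Icc a b)ᶜ = 0)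
    (hp : IsOrthogonal μ n p) (hq : IsOrthogonal μ n q) (c d : ℝ) :
    IsOrthogonal μ n (C c * p + C d * q) := by
  intro l hl
  simp only [eval_add, eval_mul, eval_C, add_mul, mul_assoc]
  rw [integral_add, integral_const_mul, integral_const_mul, hp l hl, hq l hl, mul_zero, mul_zero,
    add_zero]
  all_goals exact integrable_of_continuous hμ (by fun_prop)

theorem IsOrthogonal.integral_mul_eq_zero [IsFiniteMeasure μ] (hμ : μ (Icc a b)ᶜ = 0)
    (hQ : IsOrthogonal μ n Q) (hq : q.natDegree < n) : ∫ x, (Q * q).eval x ∂μ = 0 := by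
  simp only [eval_mul, eval_eq_sum_range' hq, Finset.mul_sum, mul_left_comm _ (q.coeff _)]
  rw [integral_finsetSum _ fun l _ => integrable_of_continuous hμ (by fun_prop)]
  refine Finset.sum_eq_zero fun l hl => ?_
  rw [integral_const_mul, hQ l (Finset.mem_range.mp hl), mul_zero]

/-- `μ` is not concentrated on a finite set. This is what makes the orthogonal polynomials of
every degree non-degenerate. -/
def HasInfiniteSupport (μ : Measure ℝ) : Prop :=
  ∀ s : Set ℝ, s.Finite → μ sᶜ ≠ 0

theorem HasInfiniteSupport.lt (hinf : HasInfiniteSupport μ) (hμ : μ (Icc a b)ᶜ = 0) : a < b := by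
  by_contra! hba
  exact hinf _ (subsingleton_Icc_of_ge hba).finite hμ

theorem HasInfiniteSupport.eq_zero_of_ae_eval_eq_zero (hinf : HasInfiniteSupport μ)
    (hQ : ∀ᵐ x ∂μ, Q.eval x = 0) : Q = 0 := by
  by_contra hQ0
  exact hinf _ (finite_setOfPred_isRoot hQ0) (mem_ae_iff.mp hQ)

theorem HasInfiniteSupport.eq_zero_of_integral_eval_eq_zero [IsFiniteMeasure μ]
    (hinf : HasInfiniteSupport μ) (hμ : μ (Icc a b)ᶜ = 0)
    (hsign : (∀ x ∈ Icc a b, 0 ≤ Q.eval x) ∨ ∀ x ∈ Icc a b, Q.eval x ≤ 0)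
    (hint : ∫ x, Q.eval x ∂μ = 0) : Q = 0 := by
  wlog hpos : ∀ x ∈ Icc a b, 0 ≤ Q.eval x generalizing Q
  · have hneg : ∀ x ∈ Icc a b, 0 ≤ (-Q).eval x := by
      simpa only [eval_neg, neg_nonneg] using hsign.resolve_left hpos
    refine neg_eq_zero.mp (this (Or.inl hneg) ?_ hneg)
    simp only [eval_neg, integral_neg, hint, neg_zero]
  · have hmem : ∀ᵐ x ∂μ, x ∈ Icc a b := mem_ae_iff.mpr hμ
    exact hinf.eq_zero_of_ae_eval_eq_zero <| (integral_eq_zero_iff_of_nonneg_ae (hmem.mono hpos)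
      (integrable_of_continuous hμ Q.continuous)).mp hint

theorem nonneg_or_nonpos_of_even_rootMultiplicity {s : Set ℝ} (hs : IsPreconnected s) (Q : ℝ[X])
    (heven : ∀ c ∈ s, Even (Q.rootMultiplicity c)) :
    (∀ x ∈ s, 0 ≤ Q.eval x) ∨ ∀ x ∈ s, Q.eval x ≤ 0 := by
  induction hd : Q.natDegree using Nat.strong_induction_on generalizing Q with
  | _ d ih =>
    subst hd
    by_cases hroot : ∃ c ∈ s, Q.eval c = 0
    · rcases eq_or_ne Q 0 with rfl | hQ0
      · simp
      obtain ⟨c, hcs, hc⟩ := hroot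
      obtain ⟨V, hQV, -⟩ := exists_eq_pow_rootMultiplicity_mul_and_not_dvd Q hQ0 c
      have hk := heven c hcs
      have hk_pos := (rootMultiplicity_pos hQ0).mpr hc
      set k := Q.rootMultiplicity c
      have hV0 : V ≠ 0 := right_ne_zero_of_mul (hQV ▸ hQ0)
      have hdeg : V.natDegree < Q.natDegree := by
        rw [hQV, natDegree_mul (pow_ne_zero _ (X_sub_C_ne_zero c)) hV0, natDegree_pow,
          natDegree_X_sub_C]
        lia
      have hV_even : ∀ d ∈ s, Even (V.rootMultiplicity d) := by
        intro d hds
        have h := heven d hds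
        rw [hQV, ← count_roots, roots_mul (hQV ▸ hQ0), roots_pow, Multiset.count_add,
          Multiset.count_nsmul, count_roots V] at h
        exact (Nat.even_add.mp h).mp (hk.mul_right _)
      have heval (x : ℝ) : Q.eval x = (x - c) ^ k * V.eval x := by
        conv_lhs => rw [hQV]
        simp
      simp only [heval]
      exact (ih _ hdeg V hV_even rfl).imp
        (fun h x hx => mul_nonneg (hk.pow_nonneg _) (h x hx))
        (fun h x hx => mul_nonpos_of_nonneg_of_nonpos (hk.pow_nonneg _) (h x hx))
    · by_contra! hsign
      obtain ⟨⟨x, hx, hx0⟩, y, hy, hy0⟩ := hsign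
      obtain ⟨c, hc⟩ := hs.intermediate_value hx hy Q.continuous.continuousOn ⟨hx0.le, hy0.le⟩
      exact hroot ⟨c, hc⟩

open scoped Classical in
/-- The zeros of `Q` in `s` at which `Q` changes sign, that is, those of odd multiplicity. -/
def oddRoots (Q : ℝ[X]) (s : Set ℝ) : Finset ℝ :=
  {c ∈ Q.roots.toFinset | c ∈ s ∧ Odd (Q.rootMultiplicity c)}

theorem mem_oddRoots {s : Set ℝ} {c : ℝ} :
    c ∈ oddRoots Q s ↔ c ∈ s ∧ Odd (Q.rootMultiplicity c) := by
  classical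
  simp only [oddRoots, Finset.mem_filter, Multiset.mem_toFinset, and_iff_right_iff_imp]
  intro h
  rw [← Multiset.count_pos, count_roots]
  exact h.2.pos

theorem nonneg_or_nonpos_mul_prod_oddRoots {s : Set ℝ} (hs : IsPreconnected s) (hQ : Q ≠ 0) :
    (∀ x ∈ s, 0 ≤ (Q * ∏ c ∈ oddRoots Q s, (X - C c)).eval x) ∨
      ∀ x ∈ s, (Q * ∏ c ∈ oddRoots Q s, (X - C c)).eval x ≤ 0 := by
  classical
  refine nonneg_or_nonpos_of_even_rootMultiplicity hs _ fun c hc => ?_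
  have hprod : (∏ c ∈ oddRoots Q s, (X - C c)) ≠ 0 := (monic_prod_X_sub_C _ _).ne_zero
  rw [rootMultiplicity_mul (mul_ne_zero hQ hprod), ← count_roots (∏ c ∈ _, _),
    roots_prod_X_sub_C, Multiset.count_eq_of_nodup (Finset.nodup _)]
  simp only [Finset.mem_val, mem_oddRoots, hc, true_and]
  split_ifs with hodd
  · exact hodd.add_one
  · exact Nat.not_odd_iff_even.mp hodd

theorem IsOrthogonal.le_card_oddRoots [IsFiniteMeasure μ] (hinf : HasInfiniteSupport μ)
    (hμ : μ (Icc a b)ᶜ = 0) (hQ0 : Q ≠ 0) (hQ : IsOrthogonal μ n Q) :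
    n ≤ (oddRoots Q (Icc a b)).card := by
  by_contra! hlt
  have hint := hQ.integral_mul_eq_zero hμ (q := ∏ c ∈ oddRoots Q (Icc a b), (X - C c))
    (by rwa [natDegree_finsetProd_X_sub_C_eq_card])
  refine mul_ne_zero hQ0 (monic_prod_X_sub_C _ _).ne_zero <|
    hinf.eq_zero_of_integral_eval_eq_zero hμ ?_ hint
  exact nonneg_or_nonpos_mul_prod_oddRoots isPreconnected_Icc hQ0

end Orthogonality

section Zeros

open Polynomial

variable {α₁ β₁ α₂ β₂ a b : ℝ} {μ μ₁ μ₂ : Measure ℝ} {n : ℕ × ℕ} {p : ℝ[X]}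

theorem mem_zerosOn {x : ℝ} : x ∈ zerosOn p a b ↔ x ∈ p.roots ∧ x ∈ Icc a b := by
  rw [zerosOn, Multiset.mem_filter]

theorem monic_factorOn (p : ℝ[X]) (a b : ℝ) : (factorOn p a b).Monic :=
  monic_multisetProd_X_sub_C _

theorem natDegree_factorOn (p : ℝ[X]) (a b : ℝ) :
    (factorOn p a b).natDegree = (zerosOn p a b).card :=
  natDegree_multiset_prod_X_sub_C_eq_card _

theorem oddRoots_val_le_zerosOn (p : ℝ[X]) (a b : ℝ) :
    (oddRoots p (Icc a b)).val ≤ zerosOn p a b := by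
  rw [Multiset.le_iff_subset (Finset.nodup _)]
  intro c hc
  rw [Finset.mem_val, mem_oddRoots] at hc
  rw [mem_zerosOn, ← Multiset.count_pos, count_roots]
  exact ⟨hc.2.pos, hc.1⟩

theorem zerosOn_add_zerosOn_le_roots (hlt : β₁ < α₂) (p : ℝ[X]) :
    zerosOn p α₁ β₁ + zerosOn p α₂ β₂ ≤ p.roots := by
  classical
  have hdisj : p.roots.filter (fun x => x ∈ Icc α₁ β₁ ∧ x ∈ Icc α₂ β₂) = 0 :=
    Multiset.filter_eq_nil.mpr fun x _ hx => absurd hlt (hx.2.1.trans hx.1.2).not_gt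
  rw [zerosOn, zerosOn, Multiset.filter_add_filter, hdisj, add_zero]
  exact Multiset.filter_le _ _

/-- An Angelesco system: two measures of infinite support that live on disjoint intervals
`[α₁, β₁]` and `[α₂, β₂]`, the first one on the left. -/
structure IsAngelescoSystem (α₁ β₁ α₂ β₂ : ℝ) (μ₁ μ₂ : Measure ℝ) : Prop where
  lt : β₁ < α₂
  measure_compl₁ : μ₁ (Icc α₁ β₁)ᶜ = 0
  measure_compl₂ : μ₂ (Icc α₂ β₂)ᶜ = 0
  infinite₁ : HasInfiniteSupport μ₁
  infinite₂ : HasInfiniteSupport μ₂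

namespace IsAngelescoSystem

variable [IsFiniteMeasure μ₁] [IsFiniteMeasure μ₂]

theorem le_card_oddRoots (h : IsAngelescoSystem α₁ β₁ α₂ β₂ μ₁ μ₂) (hp0 : p ≠ 0)
    (hp₁ : IsOrthogonal μ₁ n.1 p) (hp₂ : IsOrthogonal μ₂ n.2 p) :
    n.1 ≤ (oddRoots p (Icc α₁ β₁)).card ∧ n.2 ≤ (oddRoots p (Icc α₂ β₂)).card :=
  ⟨hp₁.le_card_oddRoots h.infinite₁ h.measure_compl₁ hp0,
    hp₂.le_card_oddRoots h.infinite₂ h.measure_compl₂ hp0⟩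

theorem card_zerosOn (h : IsAngelescoSystem α₁ β₁ α₂ β₂ μ₁ μ₂) (hp : IsTypeII μ₁ μ₂ n p) :
    (zerosOn p α₁ β₁).card = n.1 ∧ (zerosOn p α₂ β₂).card = n.2 := by
  obtain ⟨hmonic, hdeg, hp₁, hp₂⟩ := hp
  obtain ⟨hle₁, hle₂⟩ := h.le_card_oddRoots hmonic.ne_zero hp₁ hp₂
  have hodd₁ := Multiset.card_le_card (oddRoots_val_le_zerosOn p α₁ β₁)
  have hodd₂ := Multiset.card_le_card (oddRoots_val_le_zerosOn p α₂ β₂)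
  have hsum := Multiset.card_le_card (zerosOn_add_zerosOn_le_roots (α₁ := α₁) (β₂ := β₂) h.lt p)
  have hroots := card_roots' p
  rw [Multiset.card_add] at hsum
  rw [Finset.card_val] at hodd₁ hodd₂
  constructor <;> lia

theorem nodup_zerosOn (h : IsAngelescoSystem α₁ β₁ α₂ β₂ μ₁ μ₂) (hp : IsTypeII μ₁ μ₂ n p) :
    (zerosOn p α₁ β₁).Nodup := by
  rw [← Multiset.eq_of_le_of_card_le (oddRoots_val_le_zerosOn p α₁ β₁)]
  · exact Finset.nodup _
  · rw [(h.card_zerosOn hp).1]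
    exact (h.le_card_oddRoots hp.1.ne_zero hp.2.2.1 hp.2.2.2).1

theorem zerosOn_add_zerosOn (h : IsAngelescoSystem α₁ β₁ α₂ β₂ μ₁ μ₂)
    (hp : IsTypeII μ₁ μ₂ n p) : zerosOn p α₁ β₁ + zerosOn p α₂ β₂ = p.roots := by
  refine Multiset.eq_of_le_of_card_le (zerosOn_add_zerosOn_le_roots h.lt p) ?_
  rw [Multiset.card_add, (h.card_zerosOn hp).1, (h.card_zerosOn hp).2, ← hp.2.1]
  exact card_roots' p

theorem factorOn_mul_factorOn (h : IsAngelescoSystem α₁ β₁ α₂ β₂ μ₁ μ₂)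
    (hp : IsTypeII μ₁ μ₂ n p) : factorOn p α₁ β₁ * factorOn p α₂ β₂ = p := by
  have hroots := h.zerosOn_add_zerosOn hp
  rw [factorOn, factorOn, ← Multiset.prod_add, ← Multiset.map_add, hroots]
  refine prod_multiset_X_sub_C_of_monic_of_roots_card_eq hp.1 ?_
  rw [← hroots, Multiset.card_add, (h.card_zerosOn hp).1, (h.card_zerosOn hp).2, hp.2.1]

theorem cofactorOn_eq (h : IsAngelescoSystem α₁ β₁ α₂ β₂ μ₁ μ₂) (hp : IsTypeII μ₁ μ₂ n p) :
    cofactorOn p α₁ β₁ = factorOn p α₂ β₂ := by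
  have hcancel := mul_divByMonic_cancel_left (factorOn p α₂ β₂) (monic_factorOn p α₁ β₁)
  rwa [h.factorOn_mul_factorOn hp] at hcancel

end IsAngelescoSystem

end Zeros

section Interlacing

open Polynomial

variable {α₁ β₁ α₂ β₂ a b : ℝ} {μ₁ μ₂ : Measure ℝ} {m n : ℕ × ℕ} {p q Q : ℝ[X]}

theorem card_add_two_le_natDegree {R : Type*} [CommRing R] [IsDomain R] {Q : R[X]} (hQ : Q ≠ 0)
    {T : Finset R} (hT : ∀ c ∈ T, Odd (Q.rootMultiplicity c)) {t : R} (ht : Q.IsRoot t)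
    (ht' : (derivative Q).IsRoot t) : T.card + 2 ≤ Q.natDegree := by
  classical
  have hdouble : 2 ≤ Q.rootMultiplicity t :=
    (one_lt_rootMultiplicity_iff_isRoot hQ).mpr ⟨ht, ht'⟩
  suffices hle : T.val + Multiset.replicate 2 t ≤ Q.roots by
    have hcard := Multiset.card_le_card hle
    rw [Multiset.card_add, Multiset.card_replicate, Finset.card_val] at hcard
    exact hcard.trans (card_roots' Q)
  rw [Multiset.le_iff_count]
  intro c
  rw [Multiset.count_add, Multiset.count_replicate, Multiset.count_eq_of_nodup T.nodup, count_roots]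
  by_cases hc : c ∈ T
  · obtain ⟨k, hk⟩ := hT c hc
    rcases eq_or_ne t c with rfl | hne
    · simp only [Finset.mem_val, hc, if_true]
      lia
    · simp only [Finset.mem_val, hc, hne, if_true, if_false]
      lia
  · rcases eq_or_ne t c with rfl | hne
    · simpa [hc] using hdouble
    · simp [hc, hne]

theorem exists_double_root_of_eval_wronskian_eq_zero {K : Type*} [Field K] {p q : K[X]} {t : K}
    (hpq : LinearIndependent K ![p, q]) (hW : (wronskian p q).eval t = 0) :
    ∃ c d : K, C c * p + C d * q ≠ 0 ∧ (C c * p + C d * q).IsRoot t ∧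
      (derivative (C c * p + C d * q)).IsRoot t := by
  obtain ⟨v, hv0, hv⟩ := (Matrix.exists_mulVec_eq_zero_iff
    (M := !![p.eval t, q.eval t; (derivative p).eval t, (derivative q).eval t])).mpr (by
      rw [Matrix.det_fin_two_of, ← hW, wronskian]
      simp only [eval_sub, eval_mul]
      ring)
  have hroot := congrFun hv 0
  have hroot' := congrFun hv 1
  simp only [Matrix.mulVec, dotProduct, Fin.sum_univ_two, Matrix.of_apply, Matrix.cons_val_zero,
    Matrix.cons_val_one, Pi.zero_apply] at hroot hroot'
  refine ⟨v 0, v 1, fun hzero => hv0 ?_, ?_, ?_⟩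
  · simp only [← smul_eq_C_mul] at hzero
    obtain ⟨h0, h1⟩ := LinearIndependent.pair_iff.mp hpq _ _ hzero
    exact funext (Fin.forall_fin_two.mpr ⟨h0, h1⟩)
  · simp only [IsRoot, eval_add, eval_mul, eval_C]
    linear_combination hroot
  · simp only [IsRoot, derivative_add, derivative_C_mul, eval_add, eval_mul, eval_C]
    linear_combination hroot'

theorem linearIndependent_pair_of_natDegree_lt {K : Type*} [Field K] {p q : K[X]} (hp : p ≠ 0)
    (hpq : p.natDegree < q.natDegree) : LinearIndependent K ![p, q] := by
  refine LinearIndependent.pair_iff.mpr fun c d hcd => ?_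
  have hd : d = 0 := by
    have hcoeff := congrArg (coeff · q.natDegree) hcd
    simpa [coeff_eq_zero_of_natDegree_lt hpq, ne_zero_of_natDegree_gt hpq] using hcoeff
  subst hd
  exact ⟨by simpa [hp] using hcd, rfl⟩

namespace IsAngelescoSystem

variable [IsFiniteMeasure μ₁] [IsFiniteMeasure μ₂]

theorem not_isRoot_derivative (h : IsAngelescoSystem α₁ β₁ α₂ β₂ μ₁ μ₂) (hQ0 : Q ≠ 0)
    (hdeg : Q.natDegree ≤ n.1 + n.2 + 1) (hQ₁ : IsOrthogonal μ₁ n.1 Q)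
    (hQ₂ : IsOrthogonal μ₂ n.2 Q) {t : ℝ} (ht : Q.IsRoot t) : ¬ (derivative Q).IsRoot t := by
  classical
  intro ht'
  obtain ⟨hle₁, hle₂⟩ := h.le_card_oddRoots hQ0 hQ₁ hQ₂
  have hdisj : Disjoint (oddRoots Q (Icc α₁ β₁)) (oddRoots Q (Icc α₂ β₂)) := by
    refine Finset.disjoint_left.mpr fun c hc₁ hc₂ => ?_
    exact absurd h.lt ((mem_oddRoots.mp hc₂).1.1.trans (mem_oddRoots.mp hc₁).1.2).not_gt
  have hcard := card_add_two_le_natDegree hQ0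
    (T := oddRoots Q (Icc α₁ β₁) ∪ oddRoots Q (Icc α₂ β₂))
    (fun c hc => (Finset.mem_union.mp hc).elim (fun hc => (mem_oddRoots.mp hc).2)
      fun hc => (mem_oddRoots.mp hc).2) ht ht'
  rw [Finset.card_union_of_disjoint hdisj] at hcard
  lia

theorem eval_wronskian_ne_zero (h : IsAngelescoSystem α₁ β₁ α₂ β₂ μ₁ μ₂)
    (hp : IsTypeII μ₁ μ₂ n p) (hq : IsTypeII μ₁ μ₂ m q) (hle : n ≤ m)
    (hnm : m.1 + m.2 = n.1 + n.2 + 1) (t : ℝ) : (wronskian p q).eval t ≠ 0 := by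
  intro hW
  have hdeg : p.natDegree < q.natDegree := by rw [hp.2.1, hq.2.1, hnm]; exact Nat.lt_succ_self _
  obtain ⟨c, d, hQ0, hroot, hroot'⟩ := exists_double_root_of_eval_wronskian_eq_zero
    (linearIndependent_pair_of_natDegree_lt hp.1.ne_zero hdeg) hW
  refine h.not_isRoot_derivative hQ0 ?_
    (IsOrthogonal.C_mul_add_C_mul h.measure_compl₁ hp.2.2.1
      (IsOrthogonal.mono hq.2.2.1 hle.1) c d)
    (IsOrthogonal.C_mul_add_C_mul h.measure_compl₂ hp.2.2.2
      (IsOrthogonal.mono hq.2.2.2 hle.2) c d) hroot hroot'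
  rw [← hnm, ← hq.2.1]
  exact natDegree_add_le_of_degree_le ((natDegree_C_mul_le _ _).trans hdeg.le)
    (natDegree_C_mul_le _ _)

end IsAngelescoSystem

theorem exists_root_between (hW : ∀ t, (wronskian p q).eval t ≠ 0) {x y : ℝ} (hxy : x < y)
    (hx : p.IsRoot x) (hy : p.IsRoot y) : ∃ z ∈ Ioo x y, q.IsRoot z := by
  have hcommon (z : ℝ) (hpz : p.IsRoot z) : ¬ q.IsRoot z := fun hqz => hW z <| by
    simp only [wronskian, eval_sub, eval_mul, hpz.eq_zero, hqz.eq_zero, zero_mul, mul_zero,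
      sub_zero]
  by_contra! hq
  have hq_ne : ∀ z ∈ Icc x y, q.eval z ≠ 0 := by
    intro z hz
    rcases eq_endpoints_or_mem_Ioo_of_mem_Icc hz with rfl | rfl | hz
    exacts [hcommon z hx, hcommon z hy, hq z hz]
  obtain ⟨c, hc, hc0⟩ := exists_deriv_eq_zero (f := fun t => p.eval t / q.eval t) hxy
    (p.continuous.continuousOn.div q.continuous.continuousOn hq_ne)
    (by rw [hx.eq_zero, hy.eq_zero, zero_div, zero_div])
  have hqc := hq_ne c (Ioo_subset_Icc_self hc)
  have hderiv : HasDerivAt (fun t => p.eval t / q.eval t) _ c :=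
    (p.hasDerivAt c).div (q.hasDerivAt c) hqc
  rw [hderiv.deriv, div_eq_zero_iff, or_iff_left (pow_ne_zero 2 hqc)] at hc0
  apply hW c
  simp only [wronskian, eval_sub, eval_mul]
  linear_combination -hc0

theorem sum_le_sum_add_of_interleaved {ι M : Type*} [LinearOrder ι] [AddCommMonoid M]
    [PartialOrder M] [IsOrderedAddMonoid M] {A B : Finset ι} {g : ι → M} {η : M}
    (hAB : ∀ x ∈ A, ∀ y ∈ A, x < y → ∃ z ∈ B, x < z ∧ z < y)
    (hmono : MonotoneOn g (A ∪ B)) (hB : ∀ x ∈ B, 0 ≤ g x) (hη : 0 ≤ η) (hA : ∀ x ∈ A, g x ≤ η) :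
    ∑ x ∈ A, g x ≤ ∑ x ∈ B, g x + η := by
  induction A using Finset.induction_on_max generalizing B η with
  | empty => simpa using add_nonneg (Finset.sum_nonneg hB) hη
  | insert m A hlt ih =>
    have hm : g m ≤ η := hA m (Finset.mem_insert_self m A)
    rw [Finset.sum_insert fun hmA => (hlt m hmA).false, add_comm]
    rcases A.eq_empty_or_nonempty with rfl | hne
    · rw [Finset.sum_empty]
      gcongr
      exact Finset.sum_nonneg hB
    obtain ⟨z, hzB, hAz, -⟩ := hAB _ (Finset.mem_insert_of_mem (A.max'_mem hne)) m
      (Finset.mem_insert_self m A) (hlt _ (A.max'_mem hne))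
    have hA_lt (x : ι) (hx : x ∈ A) : x < z := (A.le_max' x hx).trans_lt hAz
    have hA_le : ∑ x ∈ A, g x ≤ ∑ x ∈ B.filter (· < z), g x + g z := by
      refine ih (fun x hx y hy hxy => ?_) (hmono.mono ?_)
        (fun x hx => hB x (Finset.mem_of_mem_filter x hx)) (hB z hzB) fun x hx => ?_
      · obtain ⟨t, htB, hxt, hty⟩ :=
          hAB x (Finset.mem_insert_of_mem hx) y (Finset.mem_insert_of_mem hy) hxy
        exact ⟨t, Finset.mem_filter.mpr ⟨htB, hty.trans (hA_lt y hy)⟩, hxt, hty⟩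
      · exact union_subset_union (Finset.coe_subset.mpr (Finset.subset_insert m A))
          (Finset.coe_subset.mpr (Finset.filter_subset _ B))
      · exact hmono (Or.inl (Finset.mem_insert_of_mem hx)) (Or.inr hzB) (hA_lt x hx).le
    have hB_le : ∑ x ∈ B.filter (· < z), g x + g z ≤ ∑ x ∈ B, g x := by
      rw [add_comm, ← Finset.sum_insert (by simp)]
      refine Finset.sum_le_sum_of_subset_of_nonneg ?_ fun x hx _ => hB x hx
      exact Finset.insert_subset hzB (Finset.filter_subset _ B)
    exact add_le_add (hA_le.trans hB_le) hm

theorem sum_zerosOn_le_sum_zerosOn_add (hp : (zerosOn p a b).Nodup) (hq : (zerosOn q a b).Nodup)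
    (hq0 : q ≠ 0) (hW : ∀ t, (wronskian p q).eval t ≠ 0) {g : ℝ → ℝ}
    (hmono : MonotoneOn g (Icc a b)) (hg : ∀ x ∈ Icc a b, 0 ≤ g x) {η : ℝ} (hη : 0 ≤ η)
    (hle : ∀ x ∈ zerosOn p a b, g x ≤ η) :
    ((zerosOn p a b).map g).sum ≤ ((zerosOn q a b).map g).sum + η := by
  refine sum_le_sum_add_of_interleaved (A := ⟨zerosOn p a b, hp⟩) (B := ⟨zerosOn q a b, hq⟩)
    (fun x hx y hy hxy => ?_) (hmono.mono ?_) (fun x hx => hg x (mem_zerosOn.mp hx).2) hη hle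
  · obtain ⟨hxp, hxI⟩ := mem_zerosOn.mp hx
    obtain ⟨hyp, hyI⟩ := mem_zerosOn.mp hy
    obtain ⟨z, hz, hzq⟩ :=
      exists_root_between hW hxy (isRoot_of_mem_roots hxp) (isRoot_of_mem_roots hyp)
    exact ⟨z, mem_zerosOn.mpr ⟨(mem_roots hq0).mpr hzq, hxI.1.trans hz.1.le, hz.2.le.trans hyI.2⟩,
      hz.1, hz.2⟩
  · rintro x (hx | hx) <;> exact (mem_zerosOn.mp hx).2

theorem IsAngelescoSystem.abs_sum_zerosOn_sub_sum_zerosOn_le [IsFiniteMeasure μ₁]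
    [IsFiniteMeasure μ₂] (h : IsAngelescoSystem α₁ β₁ α₂ β₂ μ₁ μ₂) (hp : IsTypeII μ₁ μ₂ n p)
    (hq : IsTypeII μ₁ μ₂ m q) (hle : n ≤ m) (hnm : m.1 + m.2 = n.1 + n.2 + 1) {g : ℝ → ℝ}
    (hmono : MonotoneOn g (Icc α₁ β₁)) (hg : ∀ x ∈ Icc α₁ β₁, 0 ≤ g x) {η : ℝ} (hη : 0 ≤ η)
    (hpη : ∀ x ∈ zerosOn p α₁ β₁, g x ≤ η) (hqη : ∀ x ∈ zerosOn q α₁ β₁, g x ≤ η) :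
    |((zerosOn q α₁ β₁).map g).sum - ((zerosOn p α₁ β₁).map g).sum| ≤ η := by
  have hW := h.eval_wronskian_ne_zero hp hq hle hnm
  have hW' (t : ℝ) : (wronskian q p).eval t ≠ 0 := by
    simpa only [← wronskian_neg_eq p q, eval_neg, neg_ne_zero] using hW t
  have hp_nodup := h.nodup_zerosOn hp
  have hq_nodup := h.nodup_zerosOn hq
  have hpq := sum_zerosOn_le_sum_zerosOn_add hp_nodup hq_nodup hq.1.ne_zero hW hmono hg hη hpη
  have hqp := sum_zerosOn_le_sum_zerosOn_add hq_nodup hp_nodup hp.1.ne_zero hW' hmono hg hη hqη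
  rw [abs_le]
  constructor <;> linarith

end Interlacing

section RootEstimate

open Polynomial

variable {μ μ₁ μ₂ : Measure ℝ} {a b α₁ β₁ α₂ β₂ : ℝ}

theorem integrableOn_log_sub (y : ℝ) {E : Set ℝ} (hE : E ⊆ Icc a b) :
    IntegrableOn (fun x => Real.log (x - y)) E := by
  rcases lt_or_ge b a with hba | hab
  · rw [Icc_eq_empty hba.not_ge, subset_empty_iff] at hE
    exact hE ▸ integrableOn_empty
  have hlog := (intervalIntegral.intervalIntegrable_log' (a := a - y) (b := b - y)).comp_sub_right y
  rw [sub_add_cancel, sub_add_cancel, intervalIntegrable_iff_integrableOn_Icc_of_le hab] at hlog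
  exact hlog.mono_set hE

theorem neg_two_le_setIntegral_log_sub {y : ℝ} {E : Set ℝ}
    (hE : IntegrableOn (fun x => Real.log (x - y)) E) : -2 ≤ ∫ x in E, Real.log (x - y) := by
  set g : ℝ → ℝ := (Ioc (y - 1) (y + 1)).indicator fun x => Real.log (x - y) with hg
  have hg_nonpos : ∀ x, g x ≤ 0 := indicator_nonpos fun x hx => by
    rw [← Real.log_abs]
    exact Real.log_nonpos (abs_nonneg _) (abs_le.mpr ⟨by linarith [hx.1], by linarith [hx.2]⟩)
  have hg_le : ∀ x, g x ≤ Real.log (x - y) := indicator_le_self' fun x hx => by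
    rw [← Real.log_abs]
    refine Real.log_nonneg (not_lt.mp fun h => hx ?_)
    exact ⟨by linarith [(abs_lt.mp h).1], by linarith [(abs_lt.mp h).2]⟩
  have hg_int : Integrable g :=
    ((integrableOn_log_sub y Ioc_subset_Icc_self).integrable_indicator measurableSet_Ioc)
  have hg_eq : ∫ x, g x = -2 := by
    rw [hg, integral_indicator measurableSet_Ioc,
      ← intervalIntegral.integral_of_le (by linarith),
      intervalIntegral.integral_comp_sub_right Real.log y, integral_log]
    norm_num
  have hneg := setIntegral_le_integral (s := E) hg_int.neg
    (Eventually.of_forall fun x => neg_nonneg.mpr (hg_nonpos x))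
  simp only [Pi.neg_apply, integral_neg, hg_eq] at hneg
  linarith [setIntegral_mono hg_int.integrableOn hE hg_le]

theorem mul_exp_pow_card_le_setIntegral_prod_sub_sq {ι : Type*} (T : Finset ι) (y : ι → ℝ)
    {E : Set ℝ} (hE : E ⊆ Icc a b) (hE0 : volume E ≠ 0) :
    volume.real E * Real.exp (-4 / volume.real E) ^ T.card ≤
      ∫ x in E, (∏ i ∈ T, (x - y i)) ^ 2 := by
  have hfin : volume E ≠ ⊤ := measure_ne_top_of_subset hE measure_Icc_lt_top.ne
  have hvol : 0 < volume.real E := ENNReal.toReal_pos hE0 hfin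
  have hlog (i : ι) : IntegrableOn (fun x => 2 * Real.log (x - y i)) E :=
    (integrableOn_log_sub (y i) hE).const_mul 2
  have hexp : (fun x => (∏ i ∈ T, (x - y i)) ^ 2) =ᵐ[volume.restrict E]
      Real.exp ∘ fun x => ∑ i ∈ T, 2 * Real.log (x - y i) := by
    have hne : ∀ᵐ x : ℝ, x ∉ y '' T :=
      measure_eq_zero_iff_ae_notMem.mp ((T.finite_toSet.image y).measure_zero volume)
    filter_upwards [ae_restrict_of_ae hne] with x hx
    rw [Function.comp, Real.exp_sum, ← Finset.prod_pow]
    refine Finset.prod_congr rfl fun i hi => ?_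
    have hxy : x - y i ≠ 0 := fun h => hx ⟨i, hi, (sub_eq_zero.mp h).symm⟩
    rw [two_mul, Real.exp_add, Real.exp_log_eq_abs hxy, abs_mul_abs_self, sq]
  have hprod : IntegrableOn (fun x => (∏ i ∈ T, (x - y i)) ^ 2) E :=
    ((by fun_prop : Continuous fun x => (∏ i ∈ T, (x - y i)) ^ 2).integrableOn_Icc).mono_set hE
  have hjensen := convexOn_exp.map_set_average_le Real.continuous_exp.continuousOn isClosed_univ
    hE0 hfin (by simp only [mem_univ, Eventually.of_forall, implies_true])
    (integrable_finsetSum T fun i _ => hlog i) (hprod.congr_fun_ae hexp)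
  have hsum : -(4 * T.card) ≤ ∫ x in E, ∑ i ∈ T, 2 * Real.log (x - y i) := by
    rw [integral_finsetSum T fun i _ => hlog i]
    refine (Finset.card_nsmul_le_sum T _ (-4) fun i _ => ?_).trans' (by rw [nsmul_eq_mul]; linarith)
    rw [integral_const_mul]
    linarith [neg_two_le_setIntegral_log_sub (integrableOn_log_sub (y i) hE)]
  rw [setAverage_eq, setAverage_eq, smul_eq_mul, smul_eq_mul, le_inv_mul_iff₀ hvol] at hjensen
  rw [integral_congr_ae hexp, ← Real.exp_nat_mul]
  refine le_trans (mul_le_mul_of_nonneg_left (Real.exp_le_exp.mpr ?_) hvol.le) hjensen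
  calc T.card * (-4 / volume.real E) = (volume.real E)⁻¹ * -(4 * T.card) := by ring
    _ ≤ _ := by gcongr

/-- The Erdős–Turán class of `[a, b]`: measures on `[a, b]` whose absolutely continuous part has
an almost everywhere positive density. Both the analytic densities and the Szegő measures belong
to it. -/
structure IsErdosTuran (μ : Measure ℝ) (a b : ℝ) : Prop where
  measure_compl : μ (Icc a b)ᶜ = 0
  density_pos : ∀ᵐ x ∂volume.restrict (Icc a b), 0 < density μ x

theorem IsSzegoMeasure.isErdosTuran (h : IsSzegoMeasure μ a b) : IsErdosTuran μ a b :=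
  ⟨h.2.1, h.2.2.1⟩

theorem HasAnalyticDensity.isErdosTuran (h : HasAnalyticDensity μ a b) : IsErdosTuran μ a b := by
  obtain ⟨U, f, -, hIU, hf, -, hpos, rfl⟩ := h
  set ρ : ℝ → ENNReal := fun x => ENNReal.ofReal (f x).re
  have hcont : ContinuousOn (fun x : ℝ => (f x).re) (Icc a b) :=
    Complex.continuous_re.comp_continuousOn
      (hf.continuousOn.comp Complex.continuous_ofReal.continuousOn hIU)
  have hmeas : AEMeasurable ((Icc a b).indicator ρ) :=
    (aemeasurable_indicator_iff measurableSet_Icc).mpr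
      (hcont.aemeasurable measurableSet_Icc).ennreal_ofReal
  refine ⟨withDensity_absolutelyContinuous _ _ ?_, ?_⟩
  · rw [Measure.restrict_apply measurableSet_Icc.compl, compl_inter_self, measure_empty]
  rw [← withDensity_indicator measurableSet_Icc]
  filter_upwards [ae_restrict_mem measurableSet_Icc,
    ae_restrict_of_ae (Measure.rnDeriv_withDensity₀ volume hmeas)] with x hx hρ
  rw [density, hρ, indicator_of_mem hx, ENNReal.toReal_ofReal (hpos x hx).2.le]
  exact (hpos x hx).2

namespace IsErdosTuran

theorem exists_smul_restrict_le [IsFiniteMeasure μ] (h : IsErdosTuran μ a b) {s : Set ℝ}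
    (hs : MeasurableSet s) (hsub : s ⊆ Icc a b) (hs0 : volume s ≠ 0) :
    ∃ m > 0, ∃ E ⊆ s, MeasurableSet E ∧ volume E ≠ 0 ∧
      ENNReal.ofReal m • volume.restrict E ≤ μ := by
  set A : ℕ → Set ℝ := fun k => s ∩ {x | ENNReal.ofReal (1 / (k + 1)) ≤ μ.rnDeriv volume x}
  have hcover : s ≤ᵐ[volume] ⋃ k, A k := by
    have hpos := (ae_restrict_iff' measurableSet_Icc).mp h.density_pos
    filter_upwards [hpos] with x hx hxs
    obtain ⟨k, hk⟩ := exists_nat_one_div_lt (hx (hsub hxs))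
    exact mem_iUnion.mpr ⟨k, hxs, (ENNReal.ofReal_le_ofReal hk.le).trans ENNReal.ofReal_toReal_le⟩
  have hunion : volume (⋃ k, A k) ≠ 0 := fun h0 =>
    hs0 (le_antisymm (h0 ▸ measure_mono_ae hcover) bot_le)
  obtain ⟨k, hk⟩ := exists_measure_pos_of_not_measure_iUnion_null hunion
  have hmeas : MeasurableSet (A k) :=
    hs.inter (measurableSet_le measurable_const (Measure.measurable_rnDeriv _ _))
  refine ⟨1 / (k + 1), Nat.one_div_pos_of_nat, A k, inter_subset_left, hmeas, hk.ne', ?_⟩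
  calc ENNReal.ofReal (1 / (k + 1)) • volume.restrict (A k)
      = (volume.restrict (A k)).withDensity fun _ => ENNReal.ofReal (1 / (k + 1)) :=
        (withDensity_const _).symm
    _ ≤ (volume.restrict (A k)).withDensity (μ.rnDeriv volume) :=
        withDensity_mono ((ae_restrict_mem hmeas).mono fun x hx => hx.2)
    _ = (volume.withDensity (μ.rnDeriv volume)).restrict (A k) :=
        (restrict_withDensity hmeas _).symm
    _ ≤ μ := Measure.restrict_le_self.trans (Measure.withDensity_rnDeriv_le _ _)

theorem hasInfiniteSupport [IsFiniteMeasure μ] (h : IsErdosTuran μ a b) (hab : a < b) :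
    HasInfiniteSupport μ := by
  intro s hs hμs
  obtain ⟨m, hm, E, -, -, hE0, hle⟩ := h.exists_smul_restrict_le measurableSet_Icc Subset.rfl
    (by simpa only [Real.volume_Icc, ne_eq, ENNReal.ofReal_eq_zero, sub_nonpos, not_le] using hab)
  have hzero := nonpos_iff_eq_zero.mp (hμs ▸ hle sᶜ)
  rw [Measure.smul_apply, smul_eq_mul, mul_eq_zero, ENNReal.ofReal_eq_zero,
    Measure.restrict_apply hs.measurableSet.compl, inter_comm, ← sdiff_eq,
    measure_sdiff_null (hs.measure_zero volume)] at hzero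
  exact hzero.elim hm.not_ge hE0

theorem isAngelescoSystem [IsFiniteMeasure μ₁] [IsFiniteMeasure μ₂]
    (hμ₁ : IsErdosTuran μ₁ α₁ β₁) (hμ₂ : IsErdosTuran μ₂ α₂ β₂) (h₁ : α₁ < β₁) (h₁₂ : β₁ < α₂)
    (h₂ : α₂ < β₂) : IsAngelescoSystem α₁ β₁ α₂ β₂ μ₁ μ₂ where
  lt := h₁₂
  measure_compl₁ := hμ₁.measure_compl
  measure_compl₂ := hμ₂.measure_compl
  infinite₁ := hμ₁.hasInfiniteSupport h₁
  infinite₂ := hμ₂.hasInfiniteSupport h₂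

end IsErdosTuran

theorem indicator_sub_le_sub_mul_mul {f V : ℝ → ℝ} {M : ℝ}
    (hfM : ∀ x ∈ Icc a b, 0 ≤ f x ∧ f x ≤ M) (hV0 : ∀ x ∈ Icc a b, 0 ≤ V x)
    (hVanti : AntitoneOn V (Icc a b)) {u y : ℝ} (hu : u ∈ Icc a b) (hy : y ∈ Icc a b)
    (huy : u ≤ y) {E : Set ℝ} (hEu : E ⊆ Icc a u) {x : ℝ} (hx : x ∈ Icc a b) :
    E.indicator (fun x => (y - u) * V u * f x) x - (b - a) * M * V y ≤
      (y - x) * f x * V x := by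
  have hVy := hV0 y hy
  have hVu := hV0 u hu
  have hab : a ≤ b := hy.1.trans hy.2
  have hM : 0 ≤ M := (hfM y hy).1.trans (hfM y hy).2
  have hfx := hfM x hx
  have hVx := hV0 x hx
  rcases le_or_gt x y with hxy | hyx
  · refine (sub_le_self _ (mul_nonneg (mul_nonneg (by linarith) hM) hVy)).trans ?_
    refine indicator_apply_le' (fun hxE => ?_)
      fun _ => mul_nonneg (mul_nonneg (by linarith) hfx.1) hVx
    have hxu := (hEu hxE).2
    calc (y - u) * V u * f x = (y - u) * f x * V u := by ring
      _ ≤ (y - x) * f x * V x := by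
        gcongr
        · exact mul_nonneg (by linarith) hfx.1
        · exact hfx.1
        · exact hVanti hx hu hxu
  · have hxE : x ∉ E := fun hxE => ((hEu hxE).2.trans huy).not_gt hyx
    rw [indicator_of_notMem hxE, zero_sub, neg_le]
    calc -((y - x) * f x * V x) = (x - y) * f x * V x := by ring
      _ ≤ (b - a) * M * V y := by
        gcongr
        · exact hfx.1
        · exact hx.2
        · exact hy.1
        · exact hfx.2
        · exact hVanti hy hx hyx.le

theorem mul_setIntegral_le_of_integral_sub_mul_eq_zero [IsFiniteMeasure μ]
    (hμ : μ (Icc a b)ᶜ = 0) {f V : ℝ → ℝ} (hf : Continuous f) (hV : Continuous V) {M : ℝ}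
    (hfM : ∀ x ∈ Icc a b, 0 ≤ f x ∧ f x ≤ M) (hV0 : ∀ x ∈ Icc a b, 0 ≤ V x)
    (hVanti : AntitoneOn V (Icc a b)) {u y : ℝ} (hu : u ∈ Icc a b) (hy : y ∈ Icc a b)
    (huy : u ≤ y) {E : Set ℝ} (hE : MeasurableSet E) (hEu : E ⊆ Icc a u)
    (h0 : ∫ x, (y - x) * f x * V x ∂μ = 0) :
    (y - u) * V u * ∫ x in E, f x ∂μ ≤ (b - a) * M * V y * μ.real univ := by
  have hmem : ∀ᵐ x ∂μ, x ∈ Icc a b := mem_ae_iff.mpr hμ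
  have hfi : Integrable f μ := integrable_of_continuous hμ hf
  have hle := integral_mono_ae
    (((hfi.const_mul ((y - u) * V u)).indicator hE).sub (integrable_const ((b - a) * M * V y)))
    (integrable_of_continuous hμ (by fun_prop)) (hmem.mono fun x hx =>
      indicator_sub_le_sub_mul_mul hfM hV0 hVanti hu hy huy hEu hx)
  simp only [Pi.sub_apply] at hle
  rw [h0, integral_sub ((hfi.const_mul _).indicator hE) (integrable_const _),
    integral_indicator hE, integral_const_mul, integral_const, smul_eq_mul] at hle
  linarith

theorem eval_multisetProd_X_sub_C (Y : Multiset ℝ) (x : ℝ) :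
    ((Y.map fun t => X - C t).prod).eval x = (-1) ^ Y.card * (Y.map fun t => t - x).prod := by
  have hneg : Y.map ((eval x) ∘ fun t => X - C t) = (Y.map fun t => t - x).map Neg.neg := by
    rw [Multiset.map_map]
    exact Multiset.map_congr rfl fun t _ => by
      simp only [Function.comp, eval_sub, eval_X, eval_C, neg_sub]
  rw [eval_multiset_prod, Multiset.map_map, hneg, Multiset.prod_map_neg, Multiset.card_map]

theorem prod_map_sub_pos {Y : Multiset ℝ} {x : ℝ} (hY : ∀ t ∈ Y, x < t) :
    0 < (Y.map fun t => t - x).prod :=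
  Multiset.prod_pos (Multiset.forall_mem_map_iff.mpr fun t ht => sub_pos.mpr (hY t ht))

theorem prod_map_sub_le_prod_map_sub {Y : Multiset ℝ} {x x' : ℝ} (hxx' : x ≤ x')
    (hY : ∀ t ∈ Y, x' ≤ t) : (Y.map fun t => t - x').prod ≤ (Y.map fun t => t - x).prod :=
  Multiset.prod_map_le_prod_map₀ _ _ (fun t ht => sub_nonneg.mpr (hY t ht))
    fun t _ => sub_le_sub_left hxx' t

theorem pow_card_mul_prod_map_sub_le {Y : Multiset ℝ} {u y δ L : ℝ} (hL : 0 < L) (hδ : 0 ≤ δ)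
    (huy : u + δ ≤ y) (hY : ∀ t ∈ Y, y ≤ t ∧ t ≤ y + L) :
    (1 + δ / L) ^ Y.card * (Y.map fun t => t - y).prod ≤ (Y.map fun t => t - u).prod := by
  rw [← Multiset.prod_replicate, ← Multiset.map_const', ← Multiset.prod_map_mul]
  refine Multiset.prod_map_le_prod_map₀ _ _
    (fun t ht => mul_nonneg (by positivity) (sub_nonneg.mpr (hY t ht).1)) fun t ht => ?_
  have hstep : δ / L * (t - y) ≤ δ := by
    rw [div_mul_eq_mul_div, div_le_iff₀ hL]
    exact mul_le_mul_of_nonneg_left (by linarith [(hY t ht).2]) hδ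
  linarith

namespace IsAngelescoSystem

variable [IsFiniteMeasure μ₁] [IsFiniteMeasure μ₂] {n : ℕ × ℕ} {p : ℝ[X]}

theorem exists_integral_sub_mul_sq_mul_prod_eq_zero
    (h : IsAngelescoSystem α₁ β₁ α₂ β₂ μ₁ μ₂) (hp : IsTypeII μ₁ μ₂ n p) {y : ℝ}
    (hy : y ∈ zerosOn p α₁ β₁) :
    ∃ T : Finset ℝ, T.card + 1 = n.1 ∧ (∀ t ∈ T, t ∈ Icc α₁ β₁) ∧
      ∫ x, (y - x) * (∏ t ∈ T, (x - t)) ^ 2 *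
        ((zerosOn p α₂ β₂).map fun t => t - x).prod ∂μ₁ = 0 := by
  have hcard : ((zerosOn p α₁ β₁).erase y).card + 1 = n.1 := by
    rw [Multiset.card_erase_add_one hy, (h.card_zerosOn hp).1]
  set T : Finset ℝ := ⟨(zerosOn p α₁ β₁).erase y, (h.nodup_zerosOn hp).erase y⟩
  refine ⟨T, hcard, fun t ht => (mem_zerosOn.mp (Multiset.mem_of_mem_erase ht)).2, ?_⟩
  set q : ℝ[X] := ∏ t ∈ T, (X - C t) with hq
  have hqdeg : q.natDegree < n.1 := by
    rw [hq, natDegree_finsetProd_X_sub_C_eq_card]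
    exact Nat.lt_of_succ_le hcard.le
  have hfactor : factorOn p α₁ β₁ = (X - C y) * q := by
    rw [factorOn, ← Multiset.cons_erase hy, Multiset.map_cons, Multiset.prod_cons]
    rfl
  have hpq (x : ℝ) : (p * q).eval x = -(-1) ^ (zerosOn p α₂ β₂).card *
      ((y - x) * (∏ t ∈ T, (x - t)) ^ 2 * ((zerosOn p α₂ β₂).map fun t => t - x).prod) := by
    nth_rw 1 [← h.factorOn_mul_factorOn hp]
    rw [hfactor, factorOn, eval_mul, eval_mul, eval_mul, eval_multisetProd_X_sub_C, hq,
      eval_prod]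
    simp only [eval_sub, eval_X, eval_C]
    ring
  have hint := IsOrthogonal.integral_mul_eq_zero h.measure_compl₁ hp.2.2.1 hqdeg
  simp_rw [hpq] at hint
  rw [integral_const_mul] at hint
  exact (mul_eq_zero.mp hint).resolve_left (neg_ne_zero.mpr (pow_ne_zero _ (by norm_num)))

end IsAngelescoSystem

theorem mul_exp_pow_card_le_setIntegral_of_smul_restrict_le [IsFiniteMeasure μ]
    (hμ : μ (Icc a b)ᶜ = 0) (T : Finset ℝ) {m : ℝ} (hm : 0 < m) {E : Set ℝ} (hE : MeasurableSet E)
    (hEab : E ⊆ Icc a b) (hE0 : volume E ≠ 0) (hle : ENNReal.ofReal m • volume.restrict E ≤ μ) :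
    m * (volume.real E * Real.exp (-4 / volume.real E) ^ T.card) ≤
      ∫ x in E, (∏ t ∈ T, (x - t)) ^ 2 ∂μ := by
  have hle' : ENNReal.ofReal m • volume.restrict E ≤ μ.restrict E := by
    have hrestrict := Measure.restrict_mono (Subset.refl E) hle
    rwa [Measure.restrict_smul, Measure.restrict_restrict hE, inter_self] at hrestrict
  have hmono := integral_mono_measure hle'
    (Eventually.of_forall fun x => sq_nonneg (∏ t ∈ T, (x - t)))
    (integrable_of_continuous hμ (by fun_prop)).integrableOn
  rw [integral_smul_measure, ENNReal.toReal_ofReal hm.le, smul_eq_mul] at hmono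
  refine le_trans ?_ hmono
  gcongr
  exact mul_exp_pow_card_le_setIntegral_prod_sub_sq T id hEab hE0

theorem prod_sub_sq_le {T : Finset ℝ} (hT : ∀ t ∈ T, t ∈ Icc a b) {x : ℝ} (hx : x ∈ Icc a b) :
    (∏ t ∈ T, (x - t)) ^ 2 ≤ ((b - a) ^ 2) ^ T.card := by
  rw [← Finset.prod_pow, ← Finset.prod_const]
  refine Finset.prod_le_prod (fun t _ => sq_nonneg _) fun t ht => sq_le_sq' ?_ ?_
  · linarith [(hT t ht).2, hx.1]
  · linarith [(hT t ht).1, hx.2]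

theorem IsAngelescoSystem.pow_mul_le_of_mem_zerosOn [IsFiniteMeasure μ₁] [IsFiniteMeasure μ₂]
    (h : IsAngelescoSystem α₁ β₁ α₂ β₂ μ₁ μ₂) {n : ℕ × ℕ} {p : ℝ[X]} (hp : IsTypeII μ₁ μ₂ n p)
    {m u δ : ℝ} (hm : 0 < m) (hδ : 0 < δ) (hu : α₁ ≤ u) {E : Set ℝ} (hE : MeasurableSet E)
    (hEu : E ⊆ Icc α₁ u) (hE0 : volume E ≠ 0) (hle : ENNReal.ofReal m • volume.restrict E ≤ μ₁)
    {y : ℝ} (hy : y ∈ zerosOn p α₁ β₁) (huy : u + δ ≤ y) :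
    ∃ k, k + 1 = n.1 ∧ (1 + δ / (β₂ - α₁)) ^ n.2 *
        (δ * (m * (volume.real E * Real.exp (-4 / volume.real E) ^ k))) ≤
      (β₁ - α₁) * ((β₁ - α₁) ^ 2) ^ k * μ₁.real univ := by
  obtain ⟨T, hTcard, hT, hint⟩ := h.exists_integral_sub_mul_sq_mul_prod_eq_zero hp hy
  have hyI := (mem_zerosOn.mp hy).2
  have huI : u ∈ Icc α₁ β₁ := ⟨hu, by linarith [hyI.2]⟩
  have hYI : ∀ t ∈ zerosOn p α₂ β₂, t ∈ Icc α₂ β₂ := fun t ht => (mem_zerosOn.mp ht).2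
  have hYβ : ∀ x ∈ Icc α₁ β₁, ∀ t ∈ zerosOn p α₂ β₂, x < t := fun x hx t ht =>
    (hx.2.trans_lt h.lt).trans_le (hYI t ht).1
  have hlen : 0 < β₂ - α₁ := by
    linarith [h.infinite₂.lt h.measure_compl₂, h.lt, hyI.1.trans hyI.2]
  set V : ℝ → ℝ := fun x => ((zerosOn p α₂ β₂).map fun t => t - x).prod
  have hVpos : ∀ x ∈ Icc α₁ β₁, 0 < V x := fun x hx => prod_map_sub_pos (hYβ x hx)
  have hVanti : AntitoneOn V (Icc α₁ β₁) := fun x _ x' hx' hxx' =>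
    prod_map_sub_le_prod_map_sub hxx' fun t ht => (hYβ x' hx' t ht).le
  have hVcont : Continuous V := continuous_multiset_prod _ fun t _ => by fun_prop
  have hVy := hVpos y hyI
  have hkey := mul_setIntegral_le_of_integral_sub_mul_eq_zero h.measure_compl₁ (by fun_prop) hVcont
    (fun x hx => ⟨sq_nonneg _, prod_sub_sq_le hT hx⟩) (fun x hx => (hVpos x hx).le) hVanti huI hyI
    (by linarith) hE hEu hint
  have hlower := mul_exp_pow_card_le_setIntegral_of_smul_restrict_le h.measure_compl₁ T hm hE
    (hEu.trans (Icc_subset_Icc_right huI.2)) hE0 hle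
  have hgrowth : (1 + δ / (β₂ - α₁)) ^ n.2 * V y ≤ V u :=
    (h.card_zerosOn hp).2 ▸ pow_card_mul_prod_map_sub_le hlen hδ.le huy fun t ht =>
      ⟨(hYβ y hyI t ht).le, by linarith [(hYI t ht).2, hyI.1]⟩
  have hyu : δ ≤ y - u := by linarith
  refine ⟨T.card, hTcard, le_of_mul_le_mul_right ?_ hVy⟩
  calc (1 + δ / (β₂ - α₁)) ^ n.2 *
        (δ * (m * (volume.real E * Real.exp (-4 / volume.real E) ^ T.card))) * V y
      = δ * ((1 + δ / (β₂ - α₁)) ^ n.2 * V y) *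
        (m * (volume.real E * Real.exp (-4 / volume.real E) ^ T.card)) := by ring
    _ ≤ (y - u) * V u * ∫ x in E, (∏ t ∈ T, (x - t)) ^ 2 ∂μ₁ := by
        gcongr
        · exact mul_nonneg (by linarith) (hVpos u huI).le
        · linarith
    _ ≤ (β₁ - α₁) * ((β₁ - α₁) ^ 2) ^ T.card * V y * μ₁.real univ := hkey
    _ = (β₁ - α₁) * ((β₁ - α₁) ^ 2) ^ T.card * μ₁.real univ * V y := by ring

theorem IsErdosTuran.exists_pow_le_of_mem_zerosOn [IsFiniteMeasure μ₁] [IsFiniteMeasure μ₂]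
    (h : IsAngelescoSystem α₁ β₁ α₂ β₂ μ₁ μ₂) (hμ₁ : IsErdosTuran μ₁ α₁ β₁) {ε : ℝ} (hε : 0 < ε) :
    ∃ κ C₀ C₁ : ℝ, 1 < κ ∧ 0 ≤ C₁ ∧ ∀ (n : ℕ × ℕ) (p : ℝ[X]), IsTypeII μ₁ μ₂ n p →
      ∀ y ∈ zerosOn p α₁ β₁, α₁ + ε ≤ y → κ ^ n.2 ≤ C₀ * C₁ ^ n.1 := by
  have h₁ : α₁ < β₁ := h.infinite₁.lt h.measure_compl₁
  have h₂ : α₂ < β₂ := h.infinite₂.lt h.measure_compl₂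
  set u := α₁ + ε / 2 with hu
  obtain ⟨m, hm, E, hEs, hE, hE0, hle⟩ := hμ₁.exists_smul_restrict_le
    (s := Icc α₁ u ∩ Icc α₁ β₁) (measurableSet_Icc.inter measurableSet_Icc) inter_subset_right (by
      rw [Icc_inter_Icc, sup_idem, Real.volume_Icc, ne_eq, ENNReal.ofReal_eq_zero, not_le, sub_pos,
        lt_inf_iff]
      exact ⟨by linarith, h₁⟩)
  set v := volume.real E
  have hv : 0 < v := ENNReal.toReal_pos hE0
    (measure_ne_top_of_subset (hEs.trans inter_subset_left) measure_Icc_lt_top.ne)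
  set c := Real.exp (-4 / v)
  have hc : 0 < c := Real.exp_pos _
  set L := β₁ - α₁
  have hL : 0 < L := sub_pos.mpr h₁
  have hκ : 0 < ε / 2 / (β₂ - α₁) := div_pos (half_pos hε) (by linarith [h.lt])
  set C := L * μ₁.real univ / (ε / 2 * (m * v)) with hC
  refine ⟨1 + ε / 2 / (β₂ - α₁), C / (L ^ 2 / c), L ^ 2 / c, by linarith, by positivity,
    fun n p hp y hy hyε => ?_⟩
  obtain ⟨k, hk, hbound⟩ := h.pow_mul_le_of_mem_zerosOn hp hm (half_pos hε) (by linarith) hE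
    (hEs.trans inter_subset_left) hE0 hle hy (by linarith)
  rw [← le_div_iff₀ (by positivity)] at hbound
  calc (1 + ε / 2 / (β₂ - α₁)) ^ n.2
      ≤ L * (L ^ 2) ^ k * μ₁.real univ / (ε / 2 * (m * (v * c ^ k))) := hbound
    _ = C / (L ^ 2 / c) * (L ^ 2 / c) ^ n.1 := by
        rw [← hk, hC, pow_succ, div_pow]
        field_simp
        ring

theorem IsMarginal.tendsto_snd {N : Set (ℕ × ℕ)} (hN : IsMarginal N) :
    Tendsto (fun n : ℕ × ℕ => n.2) (along N) atTop := by
  have hsum : Tendsto (fun n : ℕ × ℕ => n.1 + n.2) (along N) atTop :=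
    tendsto_comap.mono_left inf_le_left
  refine tendsto_atTop.mpr fun k => ?_
  filter_upwards [tendsto_atTop.mp hsum (2 * k), hN.1, hN.2.eventually (gt_mem_nhds one_pos)]
    with n hn hpos hlt
  rw [div_lt_one (by exact_mod_cast hpos)] at hlt
  have : n.1 < n.2 := by exact_mod_cast hlt
  omega

theorem IsMarginal.eventually_lt_pow {N : Set (ℕ × ℕ)} (hN : IsMarginal N) {C₀ C₁ κ : ℝ}
    (hκ : 1 < κ) (hC₁ : 0 ≤ C₁) : ∀ᶠ n in along N, C₀ * C₁ ^ n.1 < κ ^ n.2 := by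
  obtain ⟨j, hj⟩ := pow_unbounded_of_one_lt C₁ hκ
  obtain ⟨k, hk⟩ := pow_unbounded_of_one_lt C₀ hκ
  have hj0 : (0 : ℝ) < (2 * (j + 1) : ℝ)⁻¹ := by positivity
  filter_upwards [tendsto_atTop.mp hN.tendsto_snd (2 * k), hN.1,
    hN.2.eventually (gt_mem_nhds hj0)] with n hn hpos hlt
  rw [div_lt_iff₀ (by exact_mod_cast hpos), inv_mul_eq_div, lt_div_iff₀ (by positivity)] at hlt
  have hratio : n.1 * (2 * (j + 1)) < n.2 := by exact_mod_cast hlt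
  have hexp : j * n.1 + k < n.2 := by nlinarith
  calc C₀ * C₁ ^ n.1 ≤ κ ^ k * (κ ^ j) ^ n.1 := by gcongr
    _ = κ ^ (j * n.1 + k) := by rw [pow_add, pow_mul, mul_comm]
    _ < κ ^ n.2 := pow_lt_pow_right₀ hκ hexp

theorem tendsto_add_along (N : Set (ℕ × ℕ)) (v : ℕ × ℕ) :
    Tendsto (fun n => n + v) (along N) (along ((fun n => n + v) '' N)) := by
  have hsum : Tendsto (fun n : ℕ × ℕ => n.1 + n.2) (along N) atTop :=
    tendsto_comap.mono_left inf_le_left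
  refine tendsto_inf.mpr ⟨tendsto_comap_iff.mpr (tendsto_atTop_mono (fun n => ?_) hsum),
    (tendsto_principal_principal.mpr fun n hn => mem_image_of_mem _ hn).mono_left inf_le_right⟩
  simp only [Function.comp_apply, Prod.fst_add, Prod.snd_add]
  omega

theorem IsErdosTuran.eventually_mem_zerosOn_lt [IsFiniteMeasure μ₁] [IsFiniteMeasure μ₂]
    (h : IsAngelescoSystem α₁ β₁ α₂ β₂ μ₁ μ₂) (hμ₁ : IsErdosTuran μ₁ α₁ β₁)
    {P : ℕ × ℕ → ℝ[X]} (hP : ∀ n, IsTypeII μ₁ μ₂ n (P n)) {N : Set (ℕ × ℕ)} (hN : IsMarginal N)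
    (v : ℕ × ℕ) {ε : ℝ} (hε : 0 < ε) :
    ∀ᶠ n in along N, ∀ x ∈ zerosOn (P (n + v)) α₁ β₁, x < α₁ + ε := by
  obtain ⟨κ, C₀, C₁, hκ, hC₁, hbound⟩ := hμ₁.exists_pow_le_of_mem_zerosOn h hε
  filter_upwards [hN.eventually_lt_pow (C₀ := C₀ * C₁ ^ v.1) hκ hC₁] with n hn x hx
  by_contra! hfar
  refine hn.not_ge ?_
  calc κ ^ n.2 ≤ κ ^ (n + v).2 := pow_le_pow_right₀ hκ.le (Nat.le_add_right _ _)
    _ ≤ C₀ * C₁ ^ (n + v).1 := hbound (n + v) _ (hP _) x hx hfar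
    _ = C₀ * C₁ ^ v.1 * C₁ ^ n.1 := by rw [Prod.fst_add, pow_add]; ring

end RootEstimate

section RealPhi

/-- The restriction of `φ` to the real half-line left of `[a, b]`, where `w` is the negative
square root; see `phi_ofReal`. -/
def phiReal (a b x : ℝ) : ℝ :=
  (x - (a + b) / 2 - √((a - x) * (b - x))) / 2

theorem w_ofReal {a b x : ℝ} (hab : a ≤ b) (hx : x < a) :
    w a b x = -√((a - x) * (b - x)) := by
  have hm : x - (a + b) / 2 < 0 := by linarith
  have hsq : (x - (a + b) / 2) ^ 2 * (1 - ((b - a) / 2 / (x - (a + b) / 2)) ^ 2) =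
      (a - x) * (b - x) := by
    rw [div_pow, mul_sub, mul_div_cancel₀ _ (pow_ne_zero 2 hm.ne)]
    ring
  have hnonneg : 0 ≤ 1 - ((b - a) / 2 / (x - (a + b) / 2)) ^ 2 :=
    nonneg_of_mul_nonneg_right (by nlinarith) (sq_pos_of_neg hm)
  rw [← hsq, Real.sqrt_mul (sq_nonneg _), Real.sqrt_sq_eq_abs, abs_of_neg hm,
    Real.sqrt_eq_rpow, w]
  push_cast [Complex.ofReal_cpow hnonneg]
  ring

theorem phi_ofReal {a b x : ℝ} (hab : a ≤ b) (hx : x < a) : phi a b x = phiReal a b x := by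
  rw [phi, w_ofReal hab hx, phiReal]
  push_cast
  ring

theorem monotoneOn_phiReal {a b : ℝ} (hab : a ≤ b) : MonotoneOn (phiReal a b) (Iic a) := by
  intro x _ y (hy : y ≤ a) hxy
  have : √((a - y) * (b - y)) ≤ √((a - x) * (b - x)) :=
    Real.sqrt_le_sqrt (by nlinarith)
  unfold phiReal
  linarith

theorem continuous_phiReal (a b : ℝ) : Continuous (phiReal a b) := by
  unfold phiReal
  fun_prop

end RealPhi

section ZeroSums

open Polynomial

variable {α₁ β₁ α₂ β₂ : ℝ} {μ₁ μ₂ : Measure ℝ}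

theorem IsErdosTuran.tendsto_sum_zerosOn_sub_sum_zerosOn [IsFiniteMeasure μ₁] [IsFiniteMeasure μ₂]
    (h : IsAngelescoSystem α₁ β₁ α₂ β₂ μ₁ μ₂) (hμ₁ : IsErdosTuran μ₁ α₁ β₁)
    {P : ℕ × ℕ → ℝ[X]} (hP : ∀ n, IsTypeII μ₁ μ₂ n (P n)) {N : Set (ℕ × ℕ)} (hN : IsMarginal N)
    {v : ℕ × ℕ} (hv : v.1 + v.2 = 1) {g : ℝ → ℝ} (hmono : MonotoneOn g (Icc α₁ β₁))
    (hcont : ContinuousAt g α₁) (hg : g α₁ = 0) :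
    Tendsto (fun n => ((zerosOn (P (n + v)) α₁ β₁).map g).sum - ((zerosOn (P n) α₁ β₁).map g).sum)
      (along N) (𝓝 0) := by
  have hg0 : ∀ x ∈ Icc α₁ β₁, 0 ≤ g x := fun x hx =>
    hg.ge.trans (hmono (left_mem_Icc.mpr (hx.1.trans hx.2)) hx hx.1)
  rw [Metric.tendsto_nhds]
  intro η hη
  obtain ⟨δ, hδ, hnear⟩ := Metric.continuousAt_iff.mp hcont (η / 2) (half_pos hη)
  have hgη : ∀ p : ℝ[X], (∀ x ∈ zerosOn p α₁ β₁, x < α₁ + δ) →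
      ∀ x ∈ zerosOn p α₁ β₁, g x ≤ η / 2 := by
    intro p hp x hx
    have hdist : dist x α₁ < δ := by
      rw [Real.dist_eq, abs_lt]
      constructor <;> linarith [hp x hx, (mem_zerosOn.mp hx).2.1]
    have := (Real.dist_eq _ _).symm.trans_lt (hnear hdist)
    rw [hg, sub_zero] at this
    exact (le_abs_self _).trans this.le
  filter_upwards [hμ₁.eventually_mem_zerosOn_lt h hP hN 0 hδ,
    hμ₁.eventually_mem_zerosOn_lt h hP hN v hδ] with n hn hnv
  rw [add_zero] at hn
  rw [Real.dist_0_eq_abs]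
  refine lt_of_le_of_lt ?_ (half_lt_self hη)
  refine h.abs_sum_zerosOn_sub_sum_zerosOn_le (hP n) (hP (n + v)) (by simp) ?_ hmono hg0
    (half_pos hη).le (hgη _ hn) (hgη _ hnv)
  rw [Prod.fst_add, Prod.snd_add]
  omega

end ZeroSums

section Infinity

open Polynomial Bornology

theorem norm_mul_norm_le_of_tendsto_zero {E : Type*} [NormedAddCommGroup E] [NormedSpace ℂ E]
    [CompleteSpace E] {g : ℂ → E} {R ε : ℝ} (hR : 0 < R)
    (hd : ∀ z : ℂ, R < ‖z‖ → DifferentiableAt ℂ g z) (hε : ∀ z : ℂ, R < ‖z‖ → ‖g z‖ ≤ ε)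
    (h0 : Tendsto g (cobounded ℂ) (𝓝 0)) {z : ℂ} (hz : R < ‖z‖) : ‖z‖ * ‖g z‖ ≤ R * ε := by
  set f : ℂ → E := Function.update (fun ζ => g ζ⁻¹) 0 0
  have hf0 : f 0 = 0 := Function.update_self ..
  have hf : ∀ ζ ≠ 0, f ζ = g ζ⁻¹ := fun ζ hζ => Function.update_of_ne hζ ..
  have hinv : ∀ ζ ∈ Metric.ball (0 : ℂ) R⁻¹, ζ ≠ 0 → R < ‖ζ⁻¹‖ := fun ζ hζ hζ0 => by
    rwa [norm_inv, lt_inv_comm₀ hR (norm_pos_iff.mpr hζ0), ← mem_ball_zero_iff]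
  have hcont : ContinuousAt f 0 :=
    continuousAt_update_same.mpr (h0.comp tendsto_inv₀_nhdsNE_zero)
  have hdiff : DifferentiableOn ℂ f (Metric.ball 0 R⁻¹) := by
    refine (Complex.differentiableOn_compl_singleton_and_continuousAt_iff
      (Metric.ball_mem_nhds 0 (inv_pos.mpr hR))).mp ⟨fun ζ ⟨hζ, hζ0⟩ => ?_, hcont⟩
    exact (((hd _ (hinv ζ hζ hζ0)).comp ζ (differentiableAt_inv hζ0)).congr_of_eventuallyEq
      ((eventually_ne_nhds hζ0).mono hf)).differentiableWithinAt
  have hmaps : MapsTo f (Metric.ball 0 R⁻¹) (Metric.closedBall (f 0) ε) := by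
    intro ζ hζ
    rw [hf0, mem_closedBall_zero_iff]
    obtain rfl | hζ0 := eq_or_ne ζ 0
    · rw [hf0, norm_zero]
      exact (norm_nonneg _).trans (hε z hz)
    · exact hf ζ hζ0 ▸ hε _ (hinv ζ hζ hζ0)
  have hzpos : 0 < ‖z‖ := hR.trans hz
  have hmem : z⁻¹ ∈ Metric.ball (0 : ℂ) R⁻¹ := by
    rw [mem_ball_zero_iff, norm_inv]
    exact inv_strictAnti₀ hR hz
  have hschwarz := Complex.dist_le_div_mul_dist_of_mapsTo_ball hdiff hmaps hmem
  rw [hf0, hf _ (inv_ne_zero (norm_pos_iff.mp hzpos)), dist_zero_right, dist_zero_right, inv_inv,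
    norm_inv, div_inv_eq_mul, ← div_eq_mul_inv, le_div_iff₀ hzpos] at hschwarz
  linarith

/-- `f(z) = 1 + c / z + o(1 / z)` as `z → ∞`. -/
def HasInvCoeff (f : ℂ → ℂ) (c : ℂ) : Prop :=
  Tendsto (fun z => z * (f z - 1)) (cobounded ℂ) (𝓝 c)

namespace HasInvCoeff

variable {f g : ℂ → ℂ} {c d : ℂ}

theorem congr' (hf : HasInvCoeff f c) (h : f =ᶠ[cobounded ℂ] g) : HasInvCoeff g c :=
  Tendsto.congr' (h.mono fun z hz => by simp only [hz]) hf

theorem tendsto_one (hf : HasInvCoeff f c) : Tendsto f (cobounded ℂ) (𝓝 1) := by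
  have h := (tendsto_inv₀_cobounded.mul hf).add_const 1
  rw [zero_mul, zero_add] at h
  refine h.congr' ((eventually_ne_cobounded 0).mono fun z hz => ?_)
  rw [inv_mul_cancel_left₀ hz, sub_add_cancel]

theorem one : HasInvCoeff (fun _ => 1) 0 := by
  simp [HasInvCoeff]

theorem mul (hf : HasInvCoeff f c) (hg : HasInvCoeff g d) :
    HasInvCoeff (fun z => f z * g z) (c + d) := by
  have h := (Tendsto.mul hf hg.tendsto_one).add hg
  rw [mul_one] at h
  exact h.congr fun z => by ring

theorem inv (hf : HasInvCoeff f c) : HasInvCoeff (fun z => (f z)⁻¹) (-c) := by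
  have h := (Tendsto.mul hf (hf.tendsto_one.inv₀ one_ne_zero)).neg
  rw [inv_one, mul_one] at h
  refine h.congr' ((hf.tendsto_one.eventually_ne one_ne_zero).mono fun z hz => ?_)
  field_simp
  ring

theorem div (hf : HasInvCoeff f c) (hg : HasInvCoeff g d) :
    HasInvCoeff (fun z => f z / g z) (c - d) := by
  simpa only [div_eq_mul_inv, sub_eq_add_neg] using hf.mul hg.inv

theorem multiset_prod {ι : Type*} {f : ι → ℂ → ℂ} {c : ι → ℂ} (s : Multiset ι)
    (h : ∀ i ∈ s, HasInvCoeff (f i) (c i)) :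
    HasInvCoeff (fun z => (s.map fun i => f i z).prod) (s.map c).sum := by
  induction s using Multiset.induction_on with
  | empty => simpa using one
  | cons i s ih =>
    simp only [Multiset.map_cons, Multiset.prod_cons, Multiset.sum_cons]
    exact (h i (Multiset.mem_cons_self i s)).mul
      (ih fun j hj => h j (Multiset.mem_cons_of_mem hj))

theorem pow (hf : HasInvCoeff f c) (n : ℕ) : HasInvCoeff (fun z => f z ^ n) (n * c) := by
  simpa using multiset_prod (Multiset.replicate n ()) fun _ _ => hf

theorem norm_le (hf : HasInvCoeff f c) {R ε : ℝ} (hR : 0 < R)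
    (hd : ∀ z : ℂ, R < ‖z‖ → DifferentiableAt ℂ f z) (hε : ∀ z : ℂ, R < ‖z‖ → ‖f z - 1‖ ≤ ε) :
    ‖c‖ ≤ R * ε := by
  refine le_of_tendsto (Tendsto.norm hf) ?_
  filter_upwards [tendsto_norm_cobounded_atTop.eventually_gt_atTop R] with z hz
  rw [norm_mul]
  exact norm_mul_norm_le_of_tendsto_zero hR (fun z hz => (hd z hz).sub_const 1) hε
    (by simpa using hf.tendsto_one.sub_const 1) hz

theorem tendsto_zero {ι : Type*} {l : Filter ι} {f : ι → ℂ → ℂ} {c : ι → ℂ}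
    (hf : ∀ i, HasInvCoeff (f i) (c i)) {R : ℝ} (hR : 0 < R)
    (hd : ∀ᶠ i in l, ∀ z : ℂ, R < ‖z‖ → DifferentiableAt ℂ (f i) z)
    (hu : TendstoUniformlyOn f (fun _ => 1) l {z | R < ‖z‖}) : Tendsto c l (𝓝 0) := by
  rw [Metric.tendsto_nhds]
  intro δ hδ
  filter_upwards [hd, Metric.tendstoUniformlyOn_iff.mp hu (δ / (2 * R)) (by positivity)]
    with i hdi hui
  rw [dist_zero_right]
  calc ‖c i‖ ≤ R * (δ / (2 * R)) := (hf i).norm_le hR hdi fun z hz => by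
        rw [← dist_eq_norm, dist_comm]
        exact (hui z hz).le
    _ = δ / 2 := by field_simp
    _ < δ := half_lt_self hδ

end HasInvCoeff

theorem hasInvCoeff_sub_div (y : ℂ) : HasInvCoeff (fun z => (z - y) / z) (-y) := by
  refine tendsto_const_nhds.congr' ((eventually_ne_cobounded 0).mono fun z hz => ?_)
  field_simp
  ring

theorem hasInvCoeff_aeval_div_pow {p : ℝ[X]} (hp : p.Monic) :
    HasInvCoeff (fun z => aeval z p / z ^ p.natDegree) p.nextCoeff := by
  set q := p.map (algebraMap ℝ ℂ)
  have hq : q.Monic := hp.map _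
  have hsplits : q.Splits := IsAlgClosed.splits q
  have hprod := HasInvCoeff.multiset_prod q.roots fun y _ => hasInvCoeff_sub_div y
  have hcoeff : (q.roots.map fun y => -y).sum = p.nextCoeff := by
    rw [Multiset.sum_map_neg, Multiset.map_id', ← hsplits.nextCoeff_eq_neg_sum_roots_of_monic hq,
      nextCoeff_map_eq, Complex.coe_algebraMap]
  rw [hcoeff] at hprod
  refine hprod.congr' (Eventually.of_forall fun z => ?_)
  simp only
  rw [Multiset.prod_map_div, Multiset.map_const', Multiset.prod_replicate,
    ← hsplits.natDegree_eq_card_roots, natDegree_map, aeval_def, eval₂_eq_eval_map,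
    hsplits.eval_eq_prod_roots_of_monic hq]

theorem tendsto_aeval_div_sub {p q : ℝ[X]} (hp : p.Monic) (hq : q.Monic)
    (hpq : q.natDegree = p.natDegree + 1) :
    Tendsto (fun z : ℂ => aeval z q / aeval z p - z) (cobounded ℂ)
      (𝓝 (q.nextCoeff - p.nextCoeff)) := by
  refine Tendsto.congr' ?_ ((hasInvCoeff_aeval_div_pow hq).div (hasInvCoeff_aeval_div_pow hp))
  filter_upwards [eventually_ne_cobounded (0 : ℂ),
    (hasInvCoeff_aeval_div_pow hp).tendsto_one.eventually_ne one_ne_zero] with z hz hpz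
  have hpz0 : aeval z p ≠ 0 := (div_ne_zero_iff.mp hpz).1
  rw [hpq, pow_succ]
  field_simp

end Infinity

section SzegoQuotient

open Polynomial Bornology

variable {a b : ℝ}

theorem ofReal_ne_of_max_lt_norm {z : ℂ} (hz : max |a| |b| < ‖z‖) :
    ∀ x ∈ Icc a b, (x : ℂ) ≠ z := by
  rintro x hx rfl
  rw [Complex.norm_real, Real.norm_eq_abs] at hz
  exact hz.not_ge (abs_le_max_abs_abs hx.1 hx.2)

theorem ofReal_ne_ofReal {x₀ : ℝ} (hx₀ : x₀ ∉ Icc a b) : ∀ x ∈ Icc a b, (x : ℂ) ≠ x₀ :=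
  fun _ hx h => hx₀ (Complex.ofReal_injective h ▸ hx)

theorem eventually_cobounded_ofReal_ne (a b : ℝ) :
    ∀ᶠ z : ℂ in cobounded ℂ, ∀ x ∈ Icc a b, (x : ℂ) ≠ z :=
  (tendsto_norm_cobounded_atTop.eventually_gt_atTop _).mono fun _ => ofReal_ne_of_max_lt_norm

theorem eventually_nhds_ofReal_ne {z : ℂ} (hz : ∀ x ∈ Icc a b, (x : ℂ) ≠ z) :
    ∀ᶠ u in 𝓝 z, ∀ x ∈ Icc a b, (x : ℂ) ≠ u := by
  have hclosed : IsClosed ((↑) '' Icc a b : Set ℂ) :=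
    (isCompact_Icc.image Complex.continuous_ofReal).isClosed
  filter_upwards [hclosed.isOpen_compl.mem_nhds fun ⟨x, hx, hxz⟩ => hz x hx hxz]
    with u hu x hx hxu using hu ⟨x, hx, hxu⟩

theorem phi_ne_zero (hab : a < b) {z : ℂ} (hz : ∀ x ∈ Icc a b, (x : ℂ) ≠ z) : phi a b z ≠ 0 :=
  norm_pos_iff.mp ((by linarith : 0 < (b - a) / 4).trans (norm_phi_gt hab hz))

theorem phi_add_constA_div_phi (hab : a < b) {z : ℂ} (hz : ∀ x ∈ Icc a b, (x : ℂ) ≠ z) :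
    phi a b z + constA a b / phi a b z = z - ((a + b) / 2 : ℝ) := by
  have hphi := phi_ne_zero hab hz
  have hquad := phi_quadratic (a := a) (b := b)
    (hz ((a + b) / 2) ⟨by linarith, by linarith⟩).symm
  field_simp
  linear_combination hquad

theorem tendsto_mul_inv_phi (a b : ℝ) :
    Tendsto (fun z => z * (phi a b z)⁻¹) (cobounded ℂ) (𝓝 1) := by
  have h := (((hasInvCoeff_sub_div ((a + b) / 2 : ℝ)).tendsto_one.add
    (tendsto_w_div a b)).div_const 2).inv₀ (by norm_num)
  rw [one_add_one_eq_two, div_self two_ne_zero, inv_one] at h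
  refine h.congr fun z => ?_
  rw [← add_div, div_right_comm, inv_div, ← phi, div_eq_mul_inv]

theorem hasInvCoeff_phi_div (hab : a < b) :
    HasInvCoeff (fun z => phi a b z / z) (-((a + b) / 2 : ℝ)) := by
  have h := ((tendsto_inv₀_cobounded.mul (tendsto_mul_inv_phi a b)).const_mul
    (constA a b : ℂ)).const_sub (-((a + b) / 2 : ℝ) : ℂ)
  rw [zero_mul, mul_zero, sub_zero] at h
  refine h.congr' ?_
  filter_upwards [eventually_ne_cobounded 0, eventually_cobounded_ofReal_ne a b] with z hz hzI
  rw [inv_mul_cancel_left₀ hz, ← div_eq_mul_inv, mul_sub, mul_one, mul_div_cancel₀ _ hz]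
  linear_combination -phi_add_constA_div_phi hab hzI

theorem S_ne_zero (hab : a < b) {z : ℂ} (hz : ∀ x ∈ Icc a b, (x : ℂ) ≠ z) {x₀ : ℝ}
    (hx₀ : x₀ ∉ Icc a b) : S a b z x₀ ≠ 0 := by
  have hx₀' := ofReal_ne_ofReal hx₀
  rw [S_eq hab hz hx₀]
  refine div_ne_zero (mul_ne_zero (phi_ne_zero hab hx₀') (phi_ne_zero hab hz)) fun h => ?_
  have hnorm := congrArg norm (sub_eq_zero.mp h)
  rw [norm_mul, Complex.norm_real, constA, Real.norm_of_nonneg (by positivity)] at hnorm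
  nlinarith [norm_phi_gt hab hz, norm_phi_gt hab hx₀']

theorem inv_S (hab : a < b) {z : ℂ} (hz : ∀ x ∈ Icc a b, (x : ℂ) ≠ z) {x₀ : ℝ}
    (hx₀ : x₀ ∉ Icc a b) :
    (S a b z x₀)⁻¹ = 1 - constA a b / phi a b x₀ * (phi a b z)⁻¹ := by
  have := phi_ne_zero hab hz
  have := phi_ne_zero hab (ofReal_ne_ofReal hx₀)
  rw [S_eq hab hz hx₀, inv_div]
  field_simp

theorem hasInvCoeff_S (hab : a < b) {x₀ : ℝ} (hx₀ : x₀ ∉ Icc a b) :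
    HasInvCoeff (fun z => S a b z x₀) (constA a b / phi a b x₀) := by
  have h : HasInvCoeff (fun z => 1 - constA a b / phi a b x₀ * (phi a b z)⁻¹)
      (-(constA a b / phi a b x₀)) := by
    refine (((tendsto_mul_inv_phi a b).const_mul _).congr fun z => ?_).trans_eq (by rw [mul_one])
    ring
  refine neg_neg (constA a b / phi a b x₀ : ℂ) ▸ h.inv.congr' ?_
  filter_upwards [eventually_cobounded_ofReal_ne a b] with z hz
  rw [← inv_S hab hz hx₀, inv_inv]

theorem differentiableAt_phi (hab : a < b) {z : ℂ} (hz : ∀ x ∈ Icc a b, (x : ℂ) ≠ z) :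
    DifferentiableAt ℂ (phi a b) z :=
  (hasDerivAt_phi hab hz).differentiableAt

theorem differentiableAt_S (hab : a < b) {z : ℂ} (hz : ∀ x ∈ Icc a b, (x : ℂ) ≠ z) {x₀ : ℝ}
    (hx₀ : x₀ ∉ Icc a b) : DifferentiableAt ℂ (fun z => S a b z x₀) z := by
  have hinv : DifferentiableAt ℂ (fun z => 1 - constA a b / phi a b x₀ * (phi a b z)⁻¹) z :=
    (((differentiableAt_phi hab hz).inv (phi_ne_zero hab hz)).const_mul _).const_sub 1
  refine (hinv.inv ?_).congr_of_eventuallyEq ?_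
  · exact inv_S hab hz hx₀ ▸ inv_ne_zero (S_ne_zero hab hz hx₀)
  · filter_upwards [eventually_nhds_ofReal_ne hz] with u hu
    rw [Pi.inv_apply, ← inv_S hab hu hx₀, inv_inv]

/-- The quotient of `q(z)` by the main term `(∏ S(z; x)) φ(z) ^ deg q` of the asymptotic formula,
the product being over the multiset `Z`; the Szegő function, which does not depend on the
multi-index, is left out. -/
def szegoQuotient (a b : ℝ) (Z : Multiset ℝ) (q : ℝ[X]) (z : ℂ) : ℂ :=
  aeval z q / ((Z.map fun x => S a b z x).prod * phi a b z ^ q.natDegree)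

/-- The coefficient of `1 / z` in the expansion of `szegoQuotient a b Z q` at infinity, for monic
`q`; see `hasInvCoeff_szegoQuotient`. -/
def szegoQuotientCoeff (a b : ℝ) (Z : Multiset ℝ) (q : ℝ[X]) : ℂ :=
  q.nextCoeff - (Z.map fun x : ℝ => constA a b / phi a b x).sum +
    q.natDegree * ((a + b) / 2 : ℝ)

variable {Z : Multiset ℝ} {q : ℝ[X]}

theorem hasInvCoeff_szegoQuotient (hab : a < b) (hZ : ∀ x ∈ Z, x ∉ Icc a b) (hq : q.Monic) :
    HasInvCoeff (szegoQuotient a b Z q) (szegoQuotientCoeff a b Z q) := by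
  have h := (hasInvCoeff_aeval_div_pow hq).div ((HasInvCoeff.multiset_prod Z fun x hx =>
    hasInvCoeff_S hab (hZ x hx)).mul ((hasInvCoeff_phi_div hab).pow q.natDegree))
  have hcoeff : (q.nextCoeff - ((Z.map fun x : ℝ => constA a b / phi a b x).sum +
      q.natDegree * -((a + b) / 2 : ℝ)) : ℂ) = szegoQuotientCoeff a b Z q := by
    rw [szegoQuotientCoeff]
    ring
  rw [hcoeff] at h
  refine h.congr' ((eventually_ne_cobounded 0).mono fun z hz => ?_)
  simp only
  rw [szegoQuotient, div_pow, ← mul_div_assoc, div_div_div_cancel_right₀ (pow_ne_zero _ hz)]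

theorem prod_S_mul_phi_pow_ne_zero (hab : a < b) {z : ℂ} (hz : ∀ x ∈ Icc a b, (x : ℂ) ≠ z)
    (hZ : ∀ x ∈ Z, x ∉ Icc a b) (k : ℕ) :
    (Z.map fun x => S a b z x).prod * phi a b z ^ k ≠ 0 := by
  refine mul_ne_zero (Multiset.prod_ne_zero fun h => ?_) (pow_ne_zero _ (phi_ne_zero hab hz))
  obtain ⟨x, hx, hx0⟩ := Multiset.mem_map.mp h
  exact S_ne_zero hab hz (hZ x hx) hx0

theorem differentiableAt_szegoQuotient (hab : a < b) {z : ℂ} (hz : ∀ x ∈ Icc a b, (x : ℂ) ≠ z)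
    (hZ : ∀ x ∈ Z, x ∉ Icc a b) : DifferentiableAt ℂ (szegoQuotient a b Z q) z := by
  refine (q.differentiable_aeval.differentiableAt).div (DifferentiableAt.mul ?_
    ((differentiableAt_phi hab hz).pow _)) (prod_S_mul_phi_pow_ne_zero hab hz hZ _)
  classical
  exact (HasFDerivAt.multiset_prod fun x hx =>
    (differentiableAt_S hab hz (hZ x hx)).hasFDerivAt).differentiableAt

end SzegoQuotient

section Ratio

open Polynomial Bornology

variable {α₁ β₁ a b : ℝ} {μ₂ : Measure ℝ} {P : ℕ × ℕ → ℝ[X]} {N : Set (ℕ × ℕ)}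

theorem notMem_Icc_of_mem_zerosOn {p : ℝ[X]} (h : β₁ < a) :
    ∀ x ∈ zerosOn p α₁ β₁, x ∉ Icc a b :=
  fun _ hx hxI => ((mem_zerosOn.mp hx).2.2.trans_lt h).not_ge hxI.1

theorem VaryingAsymptotics.tendsto_szegoQuotient_div (h : VaryingAsymptotics α₁ β₁ a b μ₂ P N)
    (hab : a < b) (hβ : β₁ < a) (hdeg : ∀ n, (cofactorOn (P n) α₁ β₁).natDegree = n.2) {R : ℝ}
    (hR : max |a| |b| < R) :
    Tendsto (fun p : (ℕ × ℕ) × ℂ =>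
        szegoQuotient a b (zerosOn (P p.1) α₁ β₁) (cofactorOn (P p.1) α₁ β₁) p.2 /
          (szego μ₂ a b p.2 / szegoInf μ₂ a b))
      (along N ×ˢ 𝓟 {z | R < ‖z‖}) (𝓝 1) := by
  have hK : IsCompact ((fun z : ℂ => (z : OnePoint ℂ)) '' Metric.ball (0 : ℂ) R)ᶜ :=
    (OnePoint.isOpen_image_coe.mpr Metric.isOpen_ball).isClosed_compl.isCompact
  have hKI : ∀ x ∈ Icc a b,
      ((x : ℂ) : OnePoint ℂ) ∉ ((fun z : ℂ => (z : OnePoint ℂ)) '' Metric.ball (0 : ℂ) R)ᶜ := by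
    intro x hx hxK
    refine ofReal_ne_of_max_lt_norm (hR.trans_le (not_lt.mp fun hlt => ?_)) x hx rfl
    exact hxK (mem_image_of_mem _ (mem_ball_zero_iff.mpr hlt))
  rw [Metric.tendsto_nhds]
  intro ε hε
  rw [eventually_prod_principal_iff]
  filter_upwards [h.2 _ hK hKI (ε / 2) (half_pos hε)] with n hn z (hz : R < ‖z‖)
  have hzI := ofReal_ne_of_max_lt_norm (hR.trans hz)
  obtain ⟨o, ho, heq⟩ := hn z (by
    rintro ⟨y, hy, hyz⟩
    rw [OnePoint.coe_injective hyz, mem_ball_zero_iff] at hy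
    exact lt_asymm hy hz)
  have hszego : szego μ₂ a b z / szegoInf μ₂ a b ≠ 0 :=
    div_ne_zero (Complex.exp_ne_zero _) (Complex.exp_ne_zero _)
  rw [szegoQuotient, hdeg, heq, mul_assoc, mul_div_cancel_right₀ _
    (prod_S_mul_phi_pow_ne_zero hab hzI (notMem_Icc_of_mem_zerosOn hβ) _),
    mul_div_cancel_right₀ _ hszego, dist_eq_norm, add_sub_cancel_left]
  exact ho.trans_lt (half_lt_self hε)

theorem VaryingAsymptotics.tendsto_szegoQuotient_add_div_szegoQuotient
    (h : VaryingAsymptotics α₁ β₁ a b μ₂ P N) {v : ℕ × ℕ}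
    (hv : VaryingAsymptotics α₁ β₁ a b μ₂ P ((fun n => n + v) '' N)) (hab : a < b) (hβ : β₁ < a)
    (hdeg : ∀ n, (cofactorOn (P n) α₁ β₁).natDegree = n.2) {R : ℝ} (hR : max |a| |b| < R) :
    Tendsto (fun p : (ℕ × ℕ) × ℂ =>
        szegoQuotient a b (zerosOn (P (p.1 + v)) α₁ β₁) (cofactorOn (P (p.1 + v)) α₁ β₁) p.2 /
          szegoQuotient a b (zerosOn (P p.1) α₁ β₁) (cofactorOn (P p.1) α₁ β₁) p.2)
      (along N ×ˢ 𝓟 {z | R < ‖z‖}) (𝓝 1) := by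
  have hshift := (hv.tendsto_szegoQuotient_div hab hβ hdeg hR).comp
    ((tendsto_add_along N v).prodMap tendsto_id)
  have hdiv := hshift.div (h.tendsto_szegoQuotient_div hab hβ hdeg hR) one_ne_zero
  rw [div_one] at hdiv
  refine hdiv.congr fun p => div_div_div_cancel_right₀ ?_ _ _
  exact div_ne_zero (Complex.exp_ne_zero _) (Complex.exp_ne_zero _)

theorem VaryingAsymptotics.tendsto_szegoQuotientCoeff_add_sub
    (h : VaryingAsymptotics α₁ β₁ a b μ₂ P N) {v : ℕ × ℕ}
    (hv : VaryingAsymptotics α₁ β₁ a b μ₂ P ((fun n => n + v) '' N)) (hab : a < b) (hβ : β₁ < a)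
    (hmonic : ∀ n, (cofactorOn (P n) α₁ β₁).Monic)
    (hdeg : ∀ n, (cofactorOn (P n) α₁ β₁).natDegree = n.2) :
    Tendsto (fun n =>
        szegoQuotientCoeff a b (zerosOn (P (n + v)) α₁ β₁) (cofactorOn (P (n + v)) α₁ β₁) -
          szegoQuotientCoeff a b (zerosOn (P n) α₁ β₁) (cofactorOn (P n) α₁ β₁))
      (along N) (𝓝 0) := by
  have hR : max |a| |b| < max |a| |b| + 1 := lt_add_one _
  have hzeros (n : ℕ × ℕ) := notMem_Icc_of_mem_zerosOn (α₁ := α₁) (b := b) (p := P n) hβ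
  have hcoeff (n : ℕ × ℕ) := hasInvCoeff_szegoQuotient hab (hzeros n) (hmonic n)
  have hne := (h.tendsto_szegoQuotient_div hab hβ hdeg hR).eventually_ne one_ne_zero
  rw [eventually_prod_principal_iff] at hne
  refine HasInvCoeff.tendsto_zero (fun n => (hcoeff (n + v)).div (hcoeff n))
    ((le_max_of_le_left (abs_nonneg a)).trans_lt hR) ?_ (tendsto_prod_principal_iff.mp
      (h.tendsto_szegoQuotient_add_div_szegoQuotient hv hab hβ hdeg hR))
  filter_upwards [hne] with n hn z hz
  have hzI := ofReal_ne_of_max_lt_norm (hR.trans hz)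
  exact (differentiableAt_szegoQuotient hab hzI (hzeros (n + v))).div
    (differentiableAt_szegoQuotient hab hzI (hzeros n))
    (div_ne_zero_iff.mp (hn z hz)).1

end Ratio

section Limit

open Polynomial

variable {α₁ β₁ α₂ β₂ : ℝ} {μ₁ μ₂ : Measure ℝ} [IsFiniteMeasure μ₁] [IsFiniteMeasure μ₂]
  {P : ℕ × ℕ → ℝ[X]} {N : Set (ℕ × ℕ)}

theorem nextCoeff_factorOn (p : ℝ[X]) (a b : ℝ) :
    (factorOn p a b).nextCoeff = -(zerosOn p a b).sum :=
  multiset_prod_X_sub_C_nextCoeff _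

theorem constA_div_phi_ofReal {a b x : ℝ} (hab : a < b) (hx : x < a) :
    (constA a b / phi a b x : ℂ) = (x - (a + b) / 2 - phiReal a b x : ℝ) := by
  have h := phi_add_constA_div_phi hab (ofReal_ne_ofReal fun hxI => hx.not_ge hxI.1)
  rw [phi_ofReal hab.le hx] at h ⊢
  push_cast at h ⊢
  linear_combination h

theorem IsAngelescoSystem.szegoQuotientCoeff_eq (h : IsAngelescoSystem α₁ β₁ α₂ β₂ μ₁ μ₂)
    (h₂ : α₂ < β₂) {n : ℕ × ℕ} {p : ℝ[X]} (hp : IsTypeII μ₁ μ₂ n p) :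
    szegoQuotientCoeff α₂ β₂ (zerosOn p α₁ β₁) (cofactorOn p α₁ β₁) =
      p.nextCoeff + ((zerosOn p α₁ β₁).map fun x =>
        phiReal α₂ β₂ x - phiReal α₂ β₂ α₁).sum +
        n.1 * ((α₂ + β₂) / 2 + phiReal α₂ β₂ α₁ : ℝ) + n.2 * ((α₂ + β₂) / 2 : ℝ) := by
  have hsum : ((zerosOn p α₁ β₁).map fun x : ℝ => (constA α₂ β₂ / phi α₂ β₂ x : ℂ)).sum =
      (((zerosOn p α₁ β₁).map fun x =>
        x - (α₂ + β₂) / 2 - phiReal α₂ β₂ x).sum : ℝ) := by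
    refine Eq.trans ?_ (map_multiset_sum Complex.ofRealHom _).symm
    rw [Multiset.map_map]
    exact congrArg _ (Multiset.map_congr rfl fun x hx =>
      constA_div_phi_ofReal h₂ ((mem_zerosOn.mp hx).2.2.trans_lt h.lt))
  have hnext : p.nextCoeff = -(zerosOn p α₁ β₁).sum + (factorOn p α₂ β₂).nextCoeff := by
    conv_lhs => rw [← h.factorOn_mul_factorOn hp]
    rw [(monic_factorOn _ _ _).nextCoeff_mul (monic_factorOn _ _ _), nextCoeff_factorOn]
  rw [szegoQuotientCoeff, hsum, h.cofactorOn_eq hp, natDegree_factorOn, (h.card_zerosOn hp).2,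
    hnext]
  simp only [Multiset.sum_map_sub, Multiset.map_const', Multiset.sum_replicate, Multiset.map_id',
    (h.card_zerosOn hp).1, nsmul_eq_mul]
  push_cast
  ring

theorem B₀_eq_fst_mul_add_snd_mul (hα : α₁ < α₂) (h₂ : α₂ ≤ β₂) (i : Fin 2) :
    B₀ α₁ α₂ β₂ i = (e i).1 * ((α₂ + β₂) / 2 + phiReal α₂ β₂ α₁ : ℝ) +
      (e i).2 * ((α₂ + β₂) / 2 : ℝ) := by
  fin_cases i <;> simp [B₀, e, phi_ofReal h₂ hα]

theorem tendsto_nextCoeff_add_sub_nextCoeff (h : IsAngelescoSystem α₁ β₁ α₂ β₂ μ₁ μ₂)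
    (hμ₁ : IsErdosTuran μ₁ α₁ β₁) (hP : ∀ n, IsTypeII μ₁ μ₂ n (P n)) (hN : IsMarginal N)
    (hasymp : VaryingAsymptotics α₁ β₁ α₂ β₂ μ₂ P N) (i : Fin 2)
    (hshift : VaryingAsymptotics α₁ β₁ α₂ β₂ μ₂ P ((fun n => n + e i) '' N)) :
    Tendsto (fun n => ((P (n + e i)).nextCoeff - (P n).nextCoeff : ℂ)) (along N)
      (𝓝 (-B₀ α₁ α₂ β₂ i)) := by
  have h₁ : α₁ < β₁ := h.infinite₁.lt h.measure_compl₁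
  have h₂ : α₂ < β₂ := h.infinite₂.lt h.measure_compl₂
  have hcof (n : ℕ × ℕ) := h.cofactorOn_eq (hP n)
  have hcoeff := hasymp.tendsto_szegoQuotientCoeff_add_sub hshift h₂ h.lt
    (fun n => hcof n ▸ monic_factorOn _ _ _)
    (fun n => by rw [hcof, natDegree_factorOn, (h.card_zerosOn (hP n)).2])
  have hsum := hμ₁.tendsto_sum_zerosOn_sub_sum_zerosOn h hP hN (v := e i)
    (by fin_cases i <;> rfl) (g := fun x => phiReal α₂ β₂ x - phiReal α₂ β₂ α₁)
    (fun x hx y hy hxy => sub_le_sub_right (monotoneOn_phiReal h₂.le (hx.2.trans h.lt.le)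
      (hy.2.trans h.lt.le) hxy) _)
    ((continuous_phiReal α₂ β₂).sub continuous_const).continuousAt (sub_self _)
  have hlim := (hcoeff.sub ((Complex.continuous_ofReal.tendsto 0).comp hsum)).sub_const
    (B₀ α₁ α₂ β₂ i)
  rw [Complex.ofReal_zero, sub_zero, zero_sub] at hlim
  refine hlim.congr fun n => ?_
  rw [h.szegoQuotientCoeff_eq h₂ (hP n), h.szegoQuotientCoeff_eq h₂ (hP (n + e i)),
    B₀_eq_fst_mul_add_snd_mul (h₁.trans h.lt) h₂.le, Prod.fst_add, Prod.snd_add,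
    Function.comp_apply]
  push_cast
  ring

theorem natDegree_add_e (hP : ∀ n, (P n).natDegree = n.1 + n.2) (n : ℕ × ℕ) (j : Fin 2) :
    (P (n + e j)).natDegree = (P n).natDegree + 1 := by
  rw [hP, hP]
  fin_cases j <;> simp [e, add_assoc, add_comm, add_left_comm]

theorem IsRecurrence.eq_nextCoeff_sub_nextCoeff {a b : Fin 2 → ℕ × ℕ → ℝ}
    (hrec : IsRecurrence P a b) (hmonic : ∀ n, (P n).Monic)
    (hdeg : ∀ n, (P n).natDegree = n.1 + n.2) (j : Fin 2) (n : ℕ × ℕ) :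
    b j n = (P n).nextCoeff - (P (n + e j)).nextCoeff := by
  have hnext {q : ℝ[X]} (hq : q.natDegree = (P n).natDegree + 1) :
      q.nextCoeff = q.coeff (P n).natDegree := by
    rw [nextCoeff_of_natDegree_pos (hq ▸ Nat.succ_pos _), hq, Nat.add_sub_cancel]
  have hnextX : (X : ℝ[X]).nextCoeff = 0 := by
    simpa only [C_0, add_zero] using nextCoeff_X_add_C (0 : ℝ)
  have hX : (X * P n).coeff (P n).natDegree = (P n).nextCoeff := by
    rw [← hnext (by rw [monic_X.natDegree_mul (hmonic n), natDegree_X, add_comm]),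
      monic_X.nextCoeff_mul (hmonic n), hnextX, zero_add]
  have hlow {c : ℝ} {m : ℕ × ℕ} (hm : m.1 + m.2 < n.1 + n.2) :
      (C c * P m).coeff (P n).natDegree = 0 :=
    (coeff_C_mul _).trans (mul_eq_zero_of_right _
      (coeff_eq_zero_of_natDegree_lt (by rwa [hdeg, hdeg])))
  have hlow₁ : (if n.1 = 0 then 0 else C (a 0 n) * P (n.1 - 1, n.2)).coeff
      (P n).natDegree = 0 := by
    split_ifs
    · exact coeff_zero _
    · exact hlow (by lia)
  have hlow₂ : (if n.2 = 0 then 0 else C (a 1 n) * P (n.1, n.2 - 1)).coeff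
      (P n).natDegree = 0 := by
    split_ifs
    · exact coeff_zero _
    · exact hlow (by lia)
  have hcoeff := congrArg (fun q => q.coeff (P n).natDegree) (hrec n j)
  simp only [coeff_add, coeff_C_mul, (hmonic n).coeff_natDegree, hX, hlow₁, hlow₂,
    ← hnext (natDegree_add_e hdeg n j)] at hcoeff
  linarith

end Limit

end Angelesco

end

open Angelesco in
theorem mainTheorem12_general
    (α₁ β₁ α₂ β₂ : ℝ) (h₁ : α₁ < β₁) (h₁₂ : β₁ < α₂) (h₂ : α₂ < β₂)
    (μ₁ μ₂ : Measure ℝ) [IsFiniteMeasure μ₁] [IsFiniteMeasure μ₂]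
    (hμ₁ : IsErdosTuran μ₁ α₁ β₁) (hμ₂ : IsErdosTuran μ₂ α₂ β₂)
    (P : ℕ × ℕ → Polynomial ℝ) (hP : ∀ n, IsTypeII μ₁ μ₂ n (P n))
    (N : Set (ℕ × ℕ)) (hN : IsMarginal N) (hasymp : VaryingAsymptotics α₁ β₁ α₂ β₂ μ₂ P N) :
    (∀ ε > 0, ∀ᶠ n in along N, ∀ x ∈ Icc α₁ β₁, (P n).IsRoot x → |x - α₁| < ε) ∧
    ∀ i : Fin 2, VaryingAsymptotics α₁ β₁ α₂ β₂ μ₂ P ((fun n => n + e i) '' N) →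
      (∃ L : ℕ × ℕ → ℂ,
        (∀ n ∈ N, Tendsto
          (fun z : ℂ => Polynomial.aeval z (P (n + e i)) / Polynomial.aeval z (P n) - z)
          (Bornology.cobounded ℂ) (𝓝 (L n))) ∧
        Tendsto L (along N) (𝓝 (-B₀ α₁ α₂ β₂ i))) ∧
      (∀ a b : Fin 2 → ℕ × ℕ → ℝ, IsRecurrence P a b →
        Tendsto (fun n => (b i n : ℂ)) (along N) (𝓝 (B₀ α₁ α₂ β₂ i))) := by
  have h := hμ₁.isAngelescoSystem hμ₂ h₁ h₁₂ h₂
  have hmonic n := (hP n).1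
  have hdeg n := (hP n).2.1
  refine ⟨fun ε hε => ?_, fun i hshift => ?_⟩
  · filter_upwards [hμ₁.eventually_mem_zerosOn_lt h hP hN 0 hε] with n hn x hx hroot
    have hlt := hn x (mem_zerosOn.mpr ⟨Polynomial.mem_roots'.mpr
      ⟨(hmonic _).ne_zero, by rwa [add_zero]⟩, hx⟩)
    rw [abs_of_nonneg (sub_nonneg.mpr hx.1)]
    linarith
  have hlim := tendsto_nextCoeff_add_sub_nextCoeff h hμ₁ hP hN hasymp i hshift
  refine ⟨⟨_, fun n _ => tendsto_aeval_div_sub (hmonic n) (hmonic (n + e i))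
    (natDegree_add_e hdeg n i), hlim⟩, fun a b hrec => ?_⟩
  have hneg := hlim.neg
  rw [neg_neg] at hneg
  refine hneg.congr fun n => ?_
  rw [hrec.eq_nextCoeff_sub_nextCoeff hmonic hdeg i n]
  push_cast
  ring

theorem mainTheorem12
    (α₁ β₁ α₂ β₂ : ℝ) (h₁ : α₁ < β₁) (h₁₂ : β₁ < α₂) (h₂ : α₂ < β₂)
    (μ₁ μ₂ : Measure ℝ) [IsFiniteMeasure μ₁] [IsFiniteMeasure μ₂]
    (hμ₁ : Angelesco.HasAnalyticDensity μ₁ α₁ β₁)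
    (hμ₂ : Angelesco.IsSzegoMeasure μ₂ α₂ β₂)
    (P : ℕ × ℕ → Polynomial ℝ) (hP : ∀ n, Angelesco.IsTypeII μ₁ μ₂ n (P n))
    (N : Set (ℕ × ℕ)) (hN : Angelesco.IsMarginal N)
    (hasymp : Angelesco.VaryingAsymptotics α₁ β₁ α₂ β₂ μ₂ P N) :
    -- all zeros on the first interval tend to its left endpoint
    (∀ ε > 0, ∀ᶠ n in Angelesco.along N,
      ∀ x ∈ Set.Icc α₁ β₁, (P n).IsRoot x → |x - α₁| < ε) ∧
    -- ratio limits, with the formula also available for the shifted indices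
    ∀ i : Fin 2,
      Angelesco.VaryingAsymptotics α₁ β₁ α₂ β₂ μ₂ P ((fun n => n + Angelesco.e i) '' N) →
      (∃ L : ℕ × ℕ → ℂ,
        (∀ n ∈ N, Tendsto
          (fun z : ℂ => Polynomial.aeval z (P (n + Angelesco.e i)) / Polynomial.aeval z (P n) - z)
          (Bornology.cobounded ℂ) (𝓝 (L n))) ∧
        Tendsto L (Angelesco.along N) (𝓝 (-Angelesco.B₀ α₁ α₂ β₂ i))) ∧
      (∀ a b : Fin 2 → ℕ × ℕ → ℝ, Angelesco.IsRecurrence P a b →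
        Tendsto (fun n => (b i n : ℂ)) (Angelesco.along N) (𝓝 (Angelesco.B₀ α₁ α₂ β₂ i))) :=
  mainTheorem12_general α₁ β₁ α₂ β₂ h₁ h₁₂ h₂ μ₁ μ₂ hμ₁.isErdosTuran hμ₂.isErdosTuran P hP N
    hN hasymp
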